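/- Let $\mathbb P^n$ denote complex projective $n$-space. A \emph{camera} is a real $3\times4$ matrix $P$ of rank $3$, regarded as a projection $\mathbb P^3\dashrightarrow\mathbb P^2$; its \emph{center} is the point of $\mathbb P^3$ given by $\ker P$. A \emph{configuration} $(P_1,\dots,P_n,X)$ consists of $n$ cameras with pairwise distinct centers $p_1,\dots,p_n$ and a set of points $X\subseteq\mathbb P^3$. The images of a point $x$ are the tuples $(u_1,\dots,u_n)\in(\mathbb P^2)^n$ with $u_i=P_i(x)$ whenever $x\ne p_i$ ($u_i$ being arbitrary if $x=p_i$, so that these are the limits of the joint camera map $\phi_{\mathbf P}=(P_1,\dots,P_n)$ at $x$). A configuration is a \emph{reconstruction} of $S\subseteq(\mathbb P^2)^n$ if every element of $S$ is an image of some $x\in X$ and every $x\in X$ has an image in $S$ (when $X$ contains no center: $S=\phi_{\mathbf P}(X)$). Two configurations $(P_i,X)$, $(Q_i,Y)$ are \emph{equivalent} if some $H\in\mathrm{PGL}(4,\mathbb R)$ satisfies $H(X)=Y$ and $P_iH^{-1}=Q_i$ (up to scale) for all $i$, and they are \emph{conjugate} if they are nonequivalent reconstructions of the same set. The fundamental matrix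 $F_P^{ij}$ is the $3\times 3$ matrix with $\mathbf x^TF_P^{ij}\mathbf y=\det\begin{bmatrix}P_i&\mathbf x&0\\P_j&0&\mathbf y\end{bmatrix}$. A configuration is \emph{critical} (in the non-trivial sense) if it has a \emph{non-trivial conjugate}, i.e. a conjugate configuration $(Q_1,\dots,Q_n,Y)$ such that $F_P^{ij}\neq F_Q^{ij}$, up to scale, for all $i\ne j$. A \emph{twisted cubic} is the image of the curve $\{[s^3:s^2t:st^2:t^3]\}$ under a real projective transformation of $\mathbb P^3$, and a \emph{secant} of it is a line spanned by two distinct (possibly complex) points of it. Let $(P_1,P_2,P_3,X)$ be a configuration of three cameras with centers $p_1,p_2,p_3$, and let $C\subset\mathbb P^3$ be a twisted cubic with $X\subseteq C$. 1. If $C$ passes through two of the camera centers, then $(P_1,P_2,P_3,X)$ is critical. 2. If $C$ passes through only one of the camera centers, and the two remaining centers lie on a common secant of $C$, then $(P_1,P_2,P_3,X)$ is critical. 3. If all three camera centers lie on $C$, then $(P_1,P_2,P_3,X)$ is critical, and it has a non-trivial conjugate $(Q_1,Q_2,Q_3,Y)$ whose points $Y$ all lie on a (real, irreducible) conic in a plane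 of $\mathbb P^3$ that passes through none of the centers of $Q_1,Q_2,Q_3$. -/

import Mathlib

/-- Complex projective `n`-space. -/
abbrev ProjSpace (n : ℕ) : Type := Projectivization ℂ (Fin (n + 1) → ℂ)

/-- A camera: a real `3 × 4` matrix of full rank. -/
structure Camera where
  mat : Matrix (Fin 3) (Fin 4) ℝ
  rank_eq : mat.rank = 3

namespace Camera

/-- The linear map `ℂ⁴ → ℂ³` given by the (real) camera matrix. -/
noncomputable def lin (P : Camera) : (Fin 4 → ℂ) →ₗ[ℂ] (Fin 3 → ℂ) :=
  (P.mat.map ((↑) : ℝ → ℂ)).mulVecLin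

theorem exists_ker (P : Camera) : ∃ v : Fin 4 → ℂ, v ≠ 0 ∧ P.lin v = 0 := by
  have h : LinearMap.ker P.lin ≠ ⊥ := by
    apply LinearMap.ker_ne_bot_of_finrank_lt
    simp
  obtain ⟨v, hv, hv0⟩ := (Submodule.ne_bot_iff _).1 h
  exact ⟨v, hv0, hv⟩

/-- The camera center: the point of `ℙ³` given by the kernel of the camera matrix. -/
noncomputable def center (P : Camera) : ProjSpace 3 :=
  Projectivization.mk ℂ P.exists_ker.choose P.exists_ker.choose_spec.1

/-- The kernel of the camera matrix is one-dimensional, so the center is well defined. -/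
theorem ker_lin (P : Camera) : LinearMap.ker P.lin = P.center.submodule := by
  have hle : P.center.submodule ≤ LinearMap.ker P.lin := by
    rw [center, Projectivization.submodule_mk, Submodule.span_singleton_le_iff_mem]
    exact P.exists_ker.choose_spec.2
  obtain ⟨N, hN⟩ : ∃ N : Matrix (Fin 4) (Fin 3) ℝ, P.mat * N = (1 : Matrix (Fin 3) (Fin 3) ℝ) := by
    have hs : Function.Surjective P.mat.mulVecLin := by
      rw [← LinearMap.range_eq_top]
      apply Submodule.eq_top_of_finrank_eq
      have := P.rank_eq
      simpa [Matrix.rank] using this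
    exact Matrix.mulVec_surjective_iff_exists_right_inverse.1 hs
  have hsurj : Function.Surjective P.lin := by
    have : Function.Surjective (P.mat.map ((↑) : ℝ → ℂ)).mulVec := by
      rw [Matrix.mulVec_surjective_iff_exists_right_inverse]
      refine ⟨N.map ((↑) : ℝ → ℂ), ?_⟩
      have h := congrArg (fun A => A.map Complex.ofRealHom) hN
      rw [Matrix.map_mul, Matrix.map_one _ (map_zero _) (map_one _)] at h
      exact h
    exact this
  have hdim := P.lin.finrank_range_add_finrank_ker
  rw [LinearMap.range_eq_top.2 hsurj] at hdim
  simp only [finrank_top, Module.finrank_fin_fun] at hdim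
  symm
  apply Submodule.eq_of_le_of_finrank_eq hle
  rw [Projectivization.finrank_submodule]
  change 1 = Module.finrank ℂ (LinearMap.ker P.lin)
  have h4 : Module.finrank ℂ (Fin (3 + 1) → ℂ) = 4 := by simp
  have h4' : 3 + Module.finrank ℂ (LinearMap.ker P.lin) = 4 := hdim
  omega

/-- The `6 × 6` matrix with block rows `(P, x, 0)` and `(Q, 0, y)`. -/
def blockMatrix (P Q : Camera) (x y : Fin 3 → ℝ) : Matrix (Fin 6) (Fin 6) ℝ :=
  !![P.mat 0 0, P.mat 0 1, P.mat 0 2, P.mat 0 3, x 0, 0;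
     P.mat 1 0, P.mat 1 1, P.mat 1 2, P.mat 1 3, x 1, 0;
     P.mat 2 0, P.mat 2 1, P.mat 2 2, P.mat 2 3, x 2, 0;
     Q.mat 0 0, Q.mat 0 1, Q.mat 0 2, Q.mat 0 3, 0, y 0;
     Q.mat 1 0, Q.mat 1 1, Q.mat 1 2, Q.mat 1 3, 0, y 1;
     Q.mat 2 0, Q.mat 2 1, Q.mat 2 2, Q.mat 2 3, 0, y 2]

/-- The fundamental matrix `F` of two cameras, that is the matrix of the bilinear form
`xᵀ F y = det [[P, x, 0], [Q, 0, y]]`. -/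
def fundamentalMatrix (P Q : Camera) : Matrix (Fin 3) (Fin 3) ℝ :=
  Matrix.of fun a b => (blockMatrix P Q (Pi.single a 1) (Pi.single b 1)).det

open Matrix in
theorem dotProduct_fundamentalMatrix (P Q : Camera) (x y : Fin 3 → ℝ) :
    x ⬝ᵥ (fundamentalMatrix P Q *ᵥ y) = (blockMatrix P Q x y).det := by
  have h : ∀ x y, blockMatrix P Q x y =
      ((blockMatrix P Q 0 0).updateCol 4 ![x 0, x 1, x 2, 0, 0, 0]).updateCol 5
        ![0, 0, 0, y 0, y 1, y 2] := by
    intro x y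
    ext i j
    fin_cases i <;> fin_cases j <;> simp [blockMatrix]
  have hy : ∀ x y, (blockMatrix P Q x y).det =
      ∑ b, y b * (blockMatrix P Q x (Pi.single b 1)).det := by
    intro x y
    have e : (![0, 0, 0, y 0, y 1, y 2] : Fin 6 → ℝ) =
        y 0 • ![0, 0, 0, 1, 0, 0] + y 1 • ![0, 0, 0, 0, 1, 0] + y 2 • ![0, 0, 0, 0, 0, 1] := by
      ext i; fin_cases i <;> simp
    rw [h x y, e, Matrix.det_updateCol_add, Matrix.det_updateCol_add, Matrix.det_updateCol_smul,
      Matrix.det_updateCol_smul, Matrix.det_updateCol_smul, Fin.sum_univ_three,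
      h x (Pi.single 0 1), h x (Pi.single 1 1), h x (Pi.single 2 1)]
    simp
  have hx : ∀ x y, (blockMatrix P Q x y).det =
      ∑ a, x a * (blockMatrix P Q (Pi.single a 1) y).det := by
    intro x y
    have e : (![x 0, x 1, x 2, 0, 0, 0] : Fin 6 → ℝ) =
        x 0 • ![1, 0, 0, 0, 0, 0] + x 1 • ![0, 1, 0, 0, 0, 0] + x 2 • ![0, 0, 1, 0, 0, 0] := by
      ext i; fin_cases i <;> simp
    have c : (4 : Fin 6) ≠ 5 := by decide
    rw [h x y, e, Matrix.updateCol_comm _ c, Matrix.det_updateCol_add, Matrix.det_updateCol_add,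
      Matrix.det_updateCol_smul, Matrix.det_updateCol_smul, Matrix.det_updateCol_smul,
      Fin.sum_univ_three, h (Pi.single 0 1), h (Pi.single 1 1), h (Pi.single 2 1)]
    simp [Matrix.updateCol_comm _ c]
  rw [hx]
  simp_rw [hy _ y]
  simp [dotProduct, mulVec, fundamentalMatrix, mul_comm]

end Camera

/-- Equality of matrices up to a nonzero scalar. -/
def SameUpToScale {m n : Type*} (A B : Matrix m n ℝ) : Prop :=
  ∃ c : ℝ, c ≠ 0 ∧ A = c • B

/-- A configuration: `n` cameras with pairwise distinct centers, and a set of points of `ℙ³`. -/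
structure Configuration (n : ℕ) where
  camera : Fin n → Camera
  distinct : Function.Injective fun i => (camera i).center
  points : Set (ProjSpace 3)

namespace Configuration

variable {n : ℕ}

/-- The center of the `i`-th camera. -/
noncomputable def center (A : Configuration n) (i : Fin n) : ProjSpace 3 := (A.camera i).center

/-- The images of a space point `x` under the joint camera map `ℙ³ ⇢ (ℙ²)ⁿ`: the `i`-th image
point is `Pᵢ x` if `x` is not the center of `Pᵢ`, and is arbitrary if `x` is that center.  As the
centers are distinct, this is the fibre over `x` of the closure of the graph of that map. -/
def images (A : Configuration n) (x : ProjSpace 3) : Set (Fin n → ProjSpace 2) :=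
  {u | ∀ i, x.submodule.map (A.camera i).lin ≤ (u i).submodule}

/-- `A` is a reconstruction of the set `S` of image tuples: every tuple in `S` is an image of a
point of `A`, and every point of `A` has an image in `S`.  If no point of `A` is a camera center
this says that `S` is the image of the points under the joint camera map. -/
def IsReconstruction (A : Configuration n) (S : Set (Fin n → ProjSpace 2)) : Prop :=
  (∀ u ∈ S, ∃ x ∈ A.points, u ∈ A.images x) ∧ (∀ x ∈ A.points, ∃ u ∈ S, u ∈ A.images x)

/-- Two configurations are equivalent if a real projective transformation `H` of `ℙ³` takes the
points of the first to those of the second and satisfies `Pᵢ H⁻¹ = Qᵢ` up to scale. -/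
def Equivalent (A B : Configuration n) : Prop :=
  ∃ H : Matrix.GeneralLinearGroup (Fin 4) ℝ,
    (∀ y : ProjSpace 3, y ∈ B.points ↔ ∃ x ∈ A.points,
      y.submodule = x.submodule.map
        ((H : Matrix (Fin 4) (Fin 4) ℝ).map ((↑) : ℝ → ℂ)).mulVecLin) ∧
    ∀ i, SameUpToScale
      ((A.camera i).mat * ((H⁻¹ : Matrix.GeneralLinearGroup (Fin 4) ℝ) : Matrix (Fin 4) (Fin 4) ℝ))
      (B.camera i).mat

/-- Conjugate configurations: nonequivalent reconstructions of the same set. -/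
def IsConjugate (A B : Configuration n) : Prop :=
  (∃ S, A.IsReconstruction S ∧ B.IsReconstruction S) ∧ ¬ A.Equivalent B

/-- Nontrivially conjugate configurations: conjugate, and for every pair of views the two
fundamental matrices differ (up to scale). -/
def IsNontrivialConjugate (A B : Configuration n) : Prop :=
  A.IsConjugate B ∧ ∀ i j, i ≠ j →
    ¬ SameUpToScale ((A.camera i).fundamentalMatrix (A.camera j))
      ((B.camera i).fundamentalMatrix (B.camera j))

/-- A (nontrivially) critical configuration: one that has a nontrivial conjugate. -/
def IsCritical (A : Configuration n) : Prop := ∃ B, A.IsNontrivialConjugate B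

end Configuration

/-- A (real) twisted cubic, as a set of complex points: the image of
`[s : t] ↦ [s³ : s²t : st² : t³]` under a real projective transformation. -/
def IsTwistedCubic (C : Set (ProjSpace 3)) : Prop :=
  ∃ M : Matrix.GeneralLinearGroup (Fin 4) ℝ,
    C = {x | ∃ s t : ℂ, ∃ h : ((M : Matrix (Fin 4) (Fin 4) ℝ).map ((↑) : ℝ → ℂ)).mulVec
        ![s ^ 3, s ^ 2 * t, s * t ^ 2, t ^ 3] ≠ 0,
      x = Projectivization.mk ℂ _ h}

/-- A (real) irreducible conic with real points in a plane of `ℙ³`, as a set of complex points: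
the image of `[s : t] ↦ [s² : st : t²]` under a real linear embedding `ℙ² → ℙ³`. -/
def IsConic (D : Set (ProjSpace 3)) : Prop :=
  ∃ N : Matrix (Fin 4) (Fin 3) ℝ, N.rank = 3 ∧
    D = {x | ∃ s t : ℂ, ∃ h : (N.map ((↑) : ℝ → ℂ)).mulVec ![s ^ 2, s * t, t ^ 2] ≠ 0,
      x = Projectivization.mk ℂ _ h}

/-- The line through two (distinct) points of `ℙ³`. -/
def lineThrough (a b : ProjSpace 3) : Set (ProjSpace 3) :=
  {x | x.submodule ≤ a.submodule ⊔ b.submodule}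

/-- A secant of `C`: a line spanned by two distinct points of `C`. -/
def IsSecant (L C : Set (ProjSpace 3)) : Prop :=
  ∃ a ∈ C, ∃ b ∈ C, a ≠ b ∧ L = lineThrough a b

open Matrix

/-! Points of the twisted cubic are the vectors of cubic monomials in (s, t), and the engine is
contraction with a binary form. Contracting with a linear form ℓ = as + bt sends the curve point at
(s, t) to ℓ(s, t) times the conic point (s² : st : t²), so it is the projection from the curve point
(b : -a). Hence a camera centered on the curve is an invertible `G` after such a contraction, and
the image of a curve point depends on `G` but not on where along the curve the center lies. Each
construction below keeps the images of all curve points and changes the epipoles.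

All three centers on the curve: let `G i` follow projections from three collinear points onto a
plane, and put the new points on a conic in that plane. Two centers on the curve: keep the points
and the third camera, and slide these two centers along the curve to generic positions.

One center on the curve, the other two on a secant cut out by a quadratic form k: pass to the
rational normal quartic in ℙ⁴. The contraction of its points with ℓ is ℓ times the cubic point, and
with k it is k times the conic point. `exists_quarticContraction_eq` finds a point w of the secant
of the quartic given by k whose contractions with two linear forms ℓ₁, ℓ₂ are the two centers off
the cubic. The three maps ℙ⁴ ⇢ ℙ² obtained by following these contractions with the old cameras,
respectively `G`, all vanish at w, so they descend along the projection from w to cameras on ℙ³. The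
new points lie on the projected quartic.

Nontriviality is uniform: the fundamental matrix determines both epipoles up to scale, and so does
the equivalence class. One changed epipole per pair of views therefore suffices
(`exists_isNontrivialConjugate`). -/

/-! ### Real cameras, their complexification and their centers -/

theorem Camera.mulVec_surjective (P : Camera) : Function.Surjective P.mat.mulVec := by
  have hs : Function.Surjective P.mat.mulVecLin := by
    rw [← LinearMap.range_eq_top]
    apply Submodule.eq_top_of_finrank_eq
    have := P.rank_eq
    simpa [Matrix.rank] using this
  exact hs

theorem Matrix.rank_eq_of_mulVec_surjective {m n : ℕ} {N : Matrix (Fin m) (Fin n) ℝ}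
    (h : Function.Surjective N.mulVec) : N.rank = m := by
  have h' : LinearMap.range N.mulVecLin = ⊤ := LinearMap.range_eq_top.2 h
  rw [Matrix.rank, h', finrank_top, Module.finrank_fin_fun]

/-- The camera given by a real matrix whose linear map is onto. -/
def Camera.ofSurjective (N : Matrix (Fin 3) (Fin 4) ℝ) (h : Function.Surjective N.mulVec) :
    Camera := ⟨N, Matrix.rank_eq_of_mulVec_surjective h⟩

/-- A real matrix, seen as a complex one. -/
abbrev Matrix.toComplex {m n : Type*} (N : Matrix m n ℝ) : Matrix m n ℂ := N.map ((↑) : ℝ → ℂ)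

theorem Matrix.toComplex_mul {l m n : Type*} [Fintype m] (N : Matrix l m ℝ) (N' : Matrix m n ℝ) :
    (N * N').toComplex = N.toComplex * N'.toComplex := by
  ext i j
  simp [Matrix.mul_apply]

theorem Matrix.toComplex_mulVec_ofReal {m n : Type*} [Fintype n] (N : Matrix m n ℝ) (v : n → ℝ) :
    (N.toComplex *ᵥ fun i => (v i : ℂ)) = fun i => ((N *ᵥ v) i : ℂ) := by
  ext i
  simp [Matrix.mulVec, dotProduct]

theorem ofReal_comp_ne_zero {n : Type*} {v : n → ℝ} (h : v ≠ 0) : (fun i => (v i : ℂ)) ≠ 0 := by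
  intro h0
  apply h
  ext i
  simpa using congrFun h0 i

theorem Camera.exists_real_ker (P : Camera) : ∃ v : Fin 4 → ℝ, v ≠ 0 ∧ P.mat *ᵥ v = 0 := by
  have h : LinearMap.ker P.mat.mulVecLin ≠ ⊥ := by
    apply LinearMap.ker_ne_bot_of_finrank_lt
    simp
  obtain ⟨v, hv, hv0⟩ := (Submodule.ne_bot_iff _).1 h
  exact ⟨v, hv0, hv⟩

theorem Camera.center_eq_mk (P : Camera) {v : Fin 4 → ℂ} (hv : v ≠ 0)
    (h : P.mat.toComplex *ᵥ v = 0) : P.center = Projectivization.mk ℂ v hv := by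
  have hmem : v ∈ P.center.submodule := by
    rw [← P.ker_lin]
    exact h
  induction hc : P.center using Projectivization.ind with
  | h w hw =>
    rw [hc, Projectivization.submodule_mk, Submodule.mem_span_singleton] at hmem
    obtain ⟨a, ha⟩ := hmem
    rw [eq_comm, Projectivization.mk_eq_mk_iff']
    exact ⟨a, ha⟩

theorem Camera.eq_smul_of_mulVec_eq_zero (P : Camera) {v w : Fin 4 → ℝ} (hv : v ≠ 0)
    (hPv : P.mat *ᵥ v = 0) (hPw : P.mat *ᵥ w = 0) : ∃ c : ℝ, w = c • v := by
  have hdim := P.mat.mulVecLin.finrank_range_add_finrank_ker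
  have hr : Module.finrank ℝ (LinearMap.range P.mat.mulVecLin) = 3 := P.rank_eq
  rw [hr] at hdim
  have h1 : Module.finrank ℝ (LinearMap.ker P.mat.mulVecLin) = 1 := by
    simp at hdim
    omega
  obtain ⟨c, hc⟩ := (finrank_eq_one_iff_of_nonzero' (⟨v, hPv⟩ : LinearMap.ker P.mat.mulVecLin)
    (by simpa [Subtype.ext_iff] using hv)).1 h1 ⟨w, hPw⟩
  exact ⟨c, (congrArg Subtype.val hc).symm⟩

theorem Camera.mulVec_ne_zero_of_center_ne {P Q : Camera} (h : P.center ≠ Q.center)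
    {v : Fin 4 → ℝ} (hv : v ≠ 0) (hQ : Q.mat *ᵥ v = 0) : P.mat *ᵥ v ≠ 0 := by
  intro hP
  apply h
  have hv' := ofReal_comp_ne_zero hv
  rw [P.center_eq_mk hv' (by rw [toComplex_mulVec_ofReal, hP]; ext; simp),
    Q.center_eq_mk hv' (by rw [toComplex_mulVec_ofReal, hQ]; ext; simp)]

theorem Camera.center_ne_of_mulVec_ne_zero {P Q : Camera} {v : Fin 4 → ℝ}
    (hP : P.mat *ᵥ v ≠ 0) (hQ : Q.mat *ᵥ v = 0) : P.center ≠ Q.center := by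
  intro h
  have hv : (fun i => (v i : ℂ)) ∈ LinearMap.ker P.lin := by
    rw [P.ker_lin, h, ← Q.ker_lin, LinearMap.mem_ker]
    change Q.mat.toComplex *ᵥ (fun i => (v i : ℂ)) = 0
    rw [toComplex_mulVec_ofReal, hQ]
    ext
    simp
  apply ofReal_comp_ne_zero hP
  rw [← toComplex_mulVec_ofReal]
  exact hv

/-! ### The fundamental matrix determines the epipoles -/

/-- The back-projected rays of two image points meet (in a point, or in a center). -/
def Camera.RaysMeet (P Q : Camera) (x y : Fin 3 → ℝ) : Prop :=
  ∃ (v : Fin 4 → ℝ) (a b : ℝ), (v ≠ 0 ∨ a ≠ 0 ∨ b ≠ 0) ∧ P.mat *ᵥ v = a • x ∧ Q.mat *ᵥ v = b • y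

theorem Camera.raysMeet_comm (P Q : Camera) (x y : Fin 3 → ℝ) :
    P.RaysMeet Q x y ↔ Q.RaysMeet P y x := by
  constructor <;>
  · rintro ⟨v, a, b, h, hP, hQ⟩
    exact ⟨v, b, a, by tauto, hQ, hP⟩

/-- A kernel vector of the block matrix is exactly a triple (v, -a, -b) with `P` v = a x and `Q` v =
b y. -/
theorem Camera.det_blockMatrix_eq_zero_iff (P Q : Camera) (x y : Fin 3 → ℝ) :
    (Camera.blockMatrix P Q x y).det = 0 ↔ P.RaysMeet Q x y := by
  rw [← Matrix.exists_mulVec_eq_zero_iff]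
  constructor
  · rintro ⟨w, hw, h⟩
    refine ⟨![w 0, w 1, w 2, w 3], -w 4, -w 5, ?_, ?_, ?_⟩
    · by_contra! hc
      apply hw
      have h' := hc.1
      simp [← List.ofFn_inj] at h' hc
      ext i
      fin_cases i <;> simp_all
    · have h0 := congrFun h 0
      have h1 := congrFun h 1
      have h2 := congrFun h 2
      simp [blockMatrix, Matrix.mulVec, dotProduct, Fin.sum_univ_succ] at h0 h1 h2
      ext i
      fin_cases i <;> simp [Matrix.mulVec, dotProduct, Fin.sum_univ_succ] <;> linarith
    · have h0 := congrFun h 3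
      have h1 := congrFun h 4
      have h2 := congrFun h 5
      simp [blockMatrix, Matrix.mulVec, dotProduct, Fin.sum_univ_succ] at h0 h1 h2
      ext i
      fin_cases i <;> simp [Matrix.mulVec, dotProduct, Fin.sum_univ_succ] <;> linarith
  · rintro ⟨v, a, b, h, hP, hQ⟩
    refine ⟨![v 0, v 1, v 2, v 3, -a, -b], ?_, ?_⟩
    · intro h0
      have e := fun i => congrFun h0 i
      have e0 := e 0
      have e1 := e 1
      have e2 := e 2
      have e3 := e 3
      have e4 := e 4
      have e5 := e 5
      simp at e0 e1 e2 e3 e4 e5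
      have : v = 0 := by ext i; fin_cases i <;> simpa
      tauto
    · have hP' := fun i => congrFun hP i
      have hQ' := fun i => congrFun hQ i
      simp only [Matrix.mulVec, dotProduct, Fin.sum_univ_four, Pi.smul_apply, smul_eq_mul]
        at hP' hQ'
      have p0 := hP' 0
      have p1 := hP' 1
      have p2 := hP' 2
      have q0 := hQ' 0
      have q1 := hQ' 1
      have q2 := hQ' 2
      ext i
      fin_cases i <;> simp [blockMatrix, Matrix.mulVec, dotProduct, Fin.sum_univ_succ] <;> linarith

theorem Camera.raysMeet_iff_of_sameUpToScale {P Q P' Q' : Camera}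
    (h : SameUpToScale (P.fundamentalMatrix Q) (P'.fundamentalMatrix Q')) (x y : Fin 3 → ℝ) :
    P.RaysMeet Q x y ↔ P'.RaysMeet Q' x y := by
  obtain ⟨c, hc, h⟩ := h
  rw [← det_blockMatrix_eq_zero_iff, ← det_blockMatrix_eq_zero_iff,
    ← dotProduct_fundamentalMatrix, ← dotProduct_fundamentalMatrix, h, Matrix.smul_mulVec,
    dotProduct_smul, smul_eq_mul, mul_eq_zero, or_iff_right hc]

theorem exists_dotProduct_eq_zero {n : ℕ} (m : ℕ) (hm : m < n) (v : Fin m → Fin n → ℝ) :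
    ∃ f : Fin n → ℝ, f ≠ 0 ∧ ∀ i, v i ⬝ᵥ f = 0 := by
  have h : LinearMap.ker (Matrix.of v).mulVecLin ≠ ⊥ := by
    apply LinearMap.ker_ne_bot_of_finrank_lt
    simpa using hm
  obtain ⟨f, hf, hf0⟩ := (Submodule.ne_bot_iff _).1 h
  exact ⟨f, hf0, fun i => congrFun hf i⟩

/-- The left epipole spans the left kernel of the fundamental matrix. -/
theorem Camera.exists_smul_of_forall_raysMeet {P Q : Camera} {q : Fin 4 → ℝ} (hq : q ≠ 0)
    (hQq : Q.mat *ᵥ q = 0) {e : Fin 3 → ℝ} (hPq : P.mat *ᵥ q ≠ 0)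
    (h : ∀ y, P.RaysMeet Q e y) : ∃ c : ℝ, e = c • P.mat *ᵥ q := by
  obtain ⟨p, hp, hPp⟩ := P.exists_real_ker
  obtain ⟨z, hz⟩ := P.mulVec_surjective e
  -- The ray of `e` is spanned by `p` and `z`. A `y` orthogonal to its whole image under `Q` can
  -- meet it only with b = 0, that is, in the center of `Q`.
  obtain ⟨y, hy0, hy⟩ := exists_dotProduct_eq_zero 2 (by norm_num) ![Q.mat *ᵥ p, Q.mat *ᵥ z]
  have hy1 : Q.mat *ᵥ p ⬝ᵥ y = 0 := hy 0
  have hy2 : Q.mat *ᵥ z ⬝ᵥ y = 0 := hy 1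
  obtain ⟨v, a, b, hne, hPv, hQv⟩ := h y
  obtain ⟨c, hc⟩ := P.eq_smul_of_mulVec_eq_zero (w := v - a • z) hp hPp
    (by rw [Matrix.mulVec_sub, Matrix.mulVec_smul, hPv]; simp [hz])
  have hv : v = c • p + a • z := by rw [← hc]; abel
  have hb : b = 0 := by
    have h0 : (Q.mat *ᵥ v) ⬝ᵥ y = 0 := by
      rw [hv, Matrix.mulVec_add, Matrix.mulVec_smul, Matrix.mulVec_smul, add_dotProduct,
        smul_dotProduct, smul_dotProduct, hy1, hy2]
      simp
    rw [hQv, smul_dotProduct, smul_eq_mul, mul_eq_zero] at h0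
    rcases h0 with h0 | h0
    · exact h0
    · exact absurd (dotProduct_self_eq_zero.1 h0) hy0
  subst hb
  rw [zero_smul] at hQv
  obtain ⟨d, hd⟩ := Q.eq_smul_of_mulVec_eq_zero hq hQq hQv
  rw [hd, Matrix.mulVec_smul] at hPv
  by_cases ha : a = 0
  · subst ha
    rw [zero_smul, smul_eq_zero, or_iff_left hPq] at hPv
    subst hPv
    simp_all
  · refine ⟨a⁻¹ * d, ?_⟩
    rw [mul_smul, hPv, smul_smul, inv_mul_cancel₀ ha, one_smul]

theorem Camera.epipole_eq_smul {P Q P' Q' : Camera}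
    (h : ∀ x y, P.RaysMeet Q x y ↔ P'.RaysMeet Q' x y) {q q' : Fin 4 → ℝ}
    (hq : Q.mat *ᵥ q = 0) (hq' : Q'.mat *ᵥ q' = 0)
    (hPq' : P'.mat *ᵥ q' ≠ 0) : ∃ c : ℝ, P.mat *ᵥ q = c • P'.mat *ᵥ q' := by
  have hq0 : q' ≠ 0 := by rintro rfl; simp at hPq'
  refine exists_smul_of_forall_raysMeet hq0 hq' hPq' fun y => (h _ _).1 ?_
  -- The center of `Q` lies on the ray of the epipole and on the ray of every `y`.
  exact ⟨q, 1, 0, by simp, by simp, by simp [hq]⟩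

theorem Camera.epipoles_eq_smul {P Q P' Q' : Camera}
    (h : SameUpToScale (P.fundamentalMatrix Q) (P'.fundamentalMatrix Q')) {p q p' q' : Fin 4 → ℝ}
    (hp : P.mat *ᵥ p = 0) (hp' : P'.mat *ᵥ p' = 0)
    (hQp' : Q'.mat *ᵥ p' ≠ 0)
    (hq : Q.mat *ᵥ q = 0) (hq' : Q'.mat *ᵥ q' = 0)
    (hPq' : P'.mat *ᵥ q' ≠ 0) :
    (∃ c : ℝ, P.mat *ᵥ q = c • P'.mat *ᵥ q') ∧ ∃ c : ℝ, Q.mat *ᵥ p = c • Q'.mat *ᵥ p' := by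
  have h' := raysMeet_iff_of_sameUpToScale h
  refine ⟨epipole_eq_smul h' hq hq' hPq', epipole_eq_smul (fun x y => ?_) hp hp' hQp'⟩
  rw [raysMeet_comm, h', raysMeet_comm]

/-- The transformation H carries the kernel of each camera to the kernel of its counterpart, so the
epipoles agree up to scale. -/
theorem Configuration.Equivalent.epipole_eq_smul {n : ℕ} {A B : Configuration n}
    (h : A.Equivalent B) {i j : Fin n} {p q : Fin 4 → ℝ} (hp : (A.camera j).mat *ᵥ p = 0)
    (hq0 : q ≠ 0) (hq : (B.camera j).mat *ᵥ q = 0) :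
    ∃ c : ℝ, (A.camera i).mat *ᵥ p = c • (B.camera i).mat *ᵥ q := by
  obtain ⟨H, -, hH⟩ := h
  have e (k : Fin n) : ∃ c : ℝ, c ≠ 0 ∧
      (A.camera k).mat *ᵥ p = c • (B.camera k).mat *ᵥ (H.val *ᵥ p) := by
    obtain ⟨c, hc, hk⟩ := hH k
    refine ⟨c, hc, ?_⟩
    rw [← Matrix.smul_mulVec, ← hk, Matrix.mulVec_mulVec, Matrix.mul_assoc, ← Units.val_mul]
    simp
  obtain ⟨c, hc, hj⟩ := e j
  obtain ⟨d, -, hi⟩ := e i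
  rw [hp, eq_comm, smul_eq_zero, or_iff_right hc] at hj
  obtain ⟨a, ha⟩ := (B.camera j).eq_smul_of_mulVec_eq_zero hq0 hq hj
  exact ⟨d * a, by rw [hi, ha, Matrix.mulVec_smul, smul_smul]⟩

/-! ### Contraction by binary forms -/

section Forms

variable {K : Type*} [Field K]

/-- The cubic monomials in two variables. -/
def cubicMonomials (s t : K) : Fin 4 → K := ![s ^ 3, s ^ 2 * t, s * t ^ 2, t ^ 3]

/-- The quadratic monomials in two variables. -/
def quadraticMonomials (s t : K) : Fin 3 → K := ![s ^ 2, s * t, t ^ 2]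

/-- The quartic monomials in two variables. -/
def quarticMonomials (s t : K) : Fin 5 → K := ![s ^ 4, s ^ 3 * t, s ^ 2 * t ^ 2, s * t ^ 3, t ^ 4]

/-- Contraction of the dual of the cubic forms with the linear form `a s + b t`. -/
def cubicContraction (a b : K) : Matrix (Fin 3) (Fin 4) K :=
  !![a, b, 0, 0; 0, a, b, 0; 0, 0, a, b]

/-- Contraction of the dual of the quartic forms with the linear form `a s + b t`. -/
def quarticContraction (a b : K) : Matrix (Fin 4) (Fin 5) K :=
  !![a, b, 0, 0, 0; 0, a, b, 0, 0; 0, 0, a, b, 0; 0, 0, 0, a, b]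

/-- Contraction of the dual of the quartic forms with a quadratic form. -/
def quarticContractionQuadratic (k : Fin 3 → K) : Matrix (Fin 3) (Fin 5) K :=
  !![k 0, k 1, k 2, 0, 0; 0, k 0, k 1, k 2, 0; 0, 0, k 0, k 1, k 2]

/-- Contraction of the dual of the cubic forms with a quadratic form. -/
def cubicContractionQuadratic (k : Fin 3 → K) : Matrix (Fin 2) (Fin 4) K :=
  !![k 0, k 1, k 2, 0; 0, k 0, k 1, k 2]

theorem cubicMonomials_eq_zero {s t : K} : cubicMonomials s t = 0 ↔ s = 0 ∧ t = 0 := by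
  constructor
  · intro h
    have h0 := congrFun h 0
    have h3 := congrFun h 3
    simp [cubicMonomials] at h0 h3
    exact ⟨h0, h3⟩
  · rintro ⟨rfl, rfl⟩
    ext i
    fin_cases i <;> simp [cubicMonomials]

theorem quadraticMonomials_eq_zero {s t : K} : quadraticMonomials s t = 0 ↔ s = 0 ∧ t = 0 := by
  constructor
  · intro h
    have h0 := congrFun h 0
    have h3 := congrFun h 2
    simp [quadraticMonomials] at h0 h3
    exact ⟨h0, h3⟩
  · rintro ⟨rfl, rfl⟩
    ext i
    fin_cases i <;> simp [quadraticMonomials]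

/-- The linear form enters only through a scalar: the projection of the curve from any of its points
gives the same parametrized conic. This is what allows a center to move along the curve. -/
theorem cubicContraction_mulVec_cubicMonomials (a b s t : K) :
    cubicContraction a b *ᵥ cubicMonomials s t = (a * s + b * t) • quadraticMonomials s t := by
  ext i
  fin_cases i <;> simp [cubicContraction, cubicMonomials, quadraticMonomials, Matrix.mulVec,
    dotProduct, Fin.sum_univ_succ] <;> ring

theorem quarticContraction_mulVec_quarticMonomials (a b s t : K) :
    quarticContraction a b *ᵥ quarticMonomials s t = (a * s + b * t) • cubicMonomials s t := by
  ext i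
  fin_cases i <;> simp [quarticContraction, cubicMonomials, quarticMonomials, Matrix.mulVec,
    dotProduct, Fin.sum_univ_succ] <;> ring

theorem quarticContractionQuadratic_mulVec_quarticMonomials (k : Fin 3 → K) (s t : K) :
    quarticContractionQuadratic k *ᵥ quarticMonomials s t =
      (k ⬝ᵥ quadraticMonomials s t) • quadraticMonomials s t := by
  ext i
  fin_cases i <;> simp [quarticContractionQuadratic, quadraticMonomials, quarticMonomials,
    Matrix.mulVec, dotProduct, Fin.sum_univ_succ] <;> ring

theorem cubicContractionQuadratic_mulVec_cubicMonomials (k : Fin 3 → K) (s t : K) :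
    cubicContractionQuadratic k *ᵥ cubicMonomials s t = (k ⬝ᵥ quadraticMonomials s t) • ![s, t] := by
  ext i
  fin_cases i <;> simp [cubicContractionQuadratic, quadraticMonomials, cubicMonomials,
    Matrix.mulVec, dotProduct, Fin.sum_univ_succ] <;> ring

/-- Both sides pair `x` with the cubic form k · (as + bt). -/
theorem dotProduct_cubicContraction_mulVec (k : Fin 3 → K) (a b : K) (x : Fin 4 → K) :
    k ⬝ᵥ cubicContraction a b *ᵥ x = ![a, b] ⬝ᵥ cubicContractionQuadratic k *ᵥ x := by
  simp [cubicContractionQuadratic, cubicContraction, Matrix.mulVec, dotProduct, Fin.sum_univ_succ]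
  ring

/-- The equations are a two-term recursion, so for `b ≠ 0` the entries form a geometric progression
of ratio -a/b; (b, -a) is the zero of as + bt. -/
theorem cubicContraction_mulVec_eq_zero {a b : K} (h : a ≠ 0 ∨ b ≠ 0) {x : Fin 4 → K}
    (hx : cubicContraction a b *ᵥ x = 0) : ∃ c : K, x = c • cubicMonomials b (-a) := by
  have h0 := congrFun hx 0
  have h1 := congrFun hx 1
  have h2 := congrFun hx 2
  simp [cubicContraction, Matrix.mulVec, dotProduct, Fin.sum_univ_succ] at h0 h1 h2
  by_cases hb : b = 0
  · subst hb
    have ha : a ≠ 0 := by tauto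
    refine ⟨-x 3 / a ^ 3, ?_⟩
    ext i
    fin_cases i <;> simp [cubicMonomials] <;> simp_all
    field_simp
  · refine ⟨x 0 / b ^ 3, ?_⟩
    have e1 : x 1 = - a * x 0 / b := by field_simp; linear_combination h0
    have e2 : x 2 = - a * x 1 / b := by field_simp; linear_combination h1
    have e3 : x 3 = - a * x 2 / b := by field_simp; linear_combination h2
    ext i
    fin_cases i <;> simp [cubicMonomials, e3, e2, e1] <;> field_simp

theorem quarticContraction_mulVec_eq_zero {a b : K} (h : a ≠ 0 ∨ b ≠ 0) {x : Fin 5 → K}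
    (hx : quarticContraction a b *ᵥ x = 0) : ∃ c : K, x = c • quarticMonomials b (-a) := by
  have h0 := congrFun hx 0
  have h1 := congrFun hx 1
  have h2 := congrFun hx 2
  have h3 := congrFun hx 3
  simp [quarticContraction, Matrix.mulVec, dotProduct, Fin.sum_univ_succ] at h0 h1 h2 h3
  by_cases hb : b = 0
  · subst hb
    have ha : a ≠ 0 := by tauto
    refine ⟨x 4 / a ^ 4, ?_⟩
    ext i
    fin_cases i <;> simp [quarticMonomials] <;> simp_all
    field_simp
  · refine ⟨x 0 / b ^ 4, ?_⟩
    have e1 : x 1 = - a * x 0 / b := by field_simp; linear_combination h0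
    have e2 : x 2 = - a * x 1 / b := by field_simp; linear_combination h1
    have e3 : x 3 = - a * x 2 / b := by field_simp; linear_combination h2
    have e4 : x 4 = - a * x 3 / b := by field_simp; linear_combination h3
    ext i
    fin_cases i <;> simp [quarticMonomials, e4, e3, e2, e1] <;> field_simp

theorem exists_cubicContraction_mulVec_eq {a b : K} (h : a ≠ 0 ∨ b ≠ 0) (y : Fin 3 → K) :
    ∃ x, cubicContraction a b *ᵥ x = y := by
  by_cases ha : a = 0
  · have hb : b ≠ 0 := by tauto
    subst ha
    refine ⟨![0, y 0 / b, y 1 / b, y 2 / b], ?_⟩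
    ext i
    fin_cases i <;> simp [cubicContraction, Matrix.mulVec, dotProduct, Fin.sum_univ_succ] <;>
      field_simp
  · refine ⟨![(y 0 - b * ((y 1 - b * (y 2 / a)) / a)) / a, (y 1 - b * (y 2 / a)) / a, y 2 / a, 0], ?_⟩
    ext i
    fin_cases i <;> simp [cubicContraction, Matrix.mulVec, dotProduct, Fin.sum_univ_succ] <;>
      field_simp <;> ring

theorem exists_quarticContraction_mulVec_eq {a b : K} (h : a ≠ 0 ∨ b ≠ 0) (y : Fin 4 → K) :
    ∃ x, quarticContraction a b *ᵥ x = y := by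
  by_cases ha : a = 0
  · have hb : b ≠ 0 := by tauto
    subst ha
    refine ⟨![0, y 0 / b, y 1 / b, y 2 / b, y 3 / b], ?_⟩
    ext i
    fin_cases i <;> simp [quarticContraction, Matrix.mulVec, dotProduct, Fin.sum_univ_succ] <;>
      field_simp
  · refine ⟨![(y 0 - b * ((y 1 - b * ((y 2 - b * (y 3 / a)) / a)) / a)) / a,
      (y 1 - b * ((y 2 - b * (y 3 / a)) / a)) / a, (y 2 - b * (y 3 / a)) / a, y 3 / a, 0], ?_⟩
    ext i
    fin_cases i <;> simp [quarticContraction, Matrix.mulVec, dotProduct, Fin.sum_univ_succ] <;>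
      field_simp <;> ring

theorem exists_quarticContractionQuadratic_mulVec_eq {k : Fin 3 → K} (h : k ≠ 0) (y : Fin 3 → K) :
    ∃ x, quarticContractionQuadratic k *ᵥ x = y := by
  by_cases h0 : k 0 = 0
  · by_cases h1 : k 1 = 0
    · have h2 : k 2 ≠ 0 := by
        intro h2
        apply h
        ext i
        fin_cases i <;> assumption
      refine ⟨![0, 0, y 0 / k 2, y 1 / k 2, y 2 / k 2], ?_⟩
      ext i
      fin_cases i <;> simp [quarticContractionQuadratic, Matrix.mulVec, dotProduct,
        Fin.sum_univ_succ, h0, h1] <;> field_simp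
    · obtain ⟨x, hx⟩ := exists_cubicContraction_mulVec_eq (a := k 1) (b := k 2) (Or.inl h1) y
      refine ⟨Fin.cons 0 x, ?_⟩
      rw [← hx]
      ext i
      fin_cases i <;> simp [quarticContractionQuadratic, cubicContraction, Matrix.mulVec,
        dotProduct, Fin.sum_univ_succ, h0]
  · refine ⟨![(y 0 - k 1 * ((y 1 - k 1 * (y 2 / k 0)) / k 0) - k 2 * (y 2 / k 0)) / k 0,
      (y 1 - k 1 * (y 2 / k 0)) / k 0, y 2 / k 0, 0, 0], ?_⟩
    ext i
    fin_cases i <;> simp [quarticContractionQuadratic, Matrix.mulVec, dotProduct,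
      Fin.sum_univ_succ] <;> field_simp <;> ring

/-- A matrix of linear forms on the cubics vanishing at a point of the twisted cubic factors
through the contraction with the linear form of that point. -/
theorem exists_eq_mul_cubicContraction {a b : K} (h : a ≠ 0 ∨ b ≠ 0)
    {R : Matrix (Fin 3) (Fin 4) K} (hR : R *ᵥ cubicMonomials b (-a) = 0) :
    ∃ G : Matrix (Fin 3) (Fin 3) K, R = G * cubicContraction a b := by
  -- Each row is a cubic form vanishing at (b, -a), hence divisible by as + bt; the rows of `G` are
  -- the quotients.
  have hr : ∀ i, R i 0 * b ^ 3 - R i 1 * b ^ 2 * a + R i 2 * b * a ^ 2 - R i 3 * a ^ 3 = 0 := by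
    intro i
    have := congrFun hR i
    simp [Matrix.mulVec, dotProduct, cubicMonomials, Fin.sum_univ_four] at this
    linear_combination this
  by_cases ha : a = 0
  · have hb : b ≠ 0 := by tauto
    subst ha
    refine ⟨Matrix.of fun i => ![R i 1 / b, R i 2 / b, R i 3 / b], ?_⟩
    ext i j
    have := hr i
    simp [hb] at this
    fin_cases j <;> simp [cubicContraction, Matrix.mul_apply, Fin.sum_univ_succ, this] <;>
      field_simp
  · refine ⟨Matrix.of fun i => ![R i 0 / a, (R i 1 - b * (R i 0 / a)) / a,
      (R i 2 - b * ((R i 1 - b * (R i 0 / a)) / a)) / a], ?_⟩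
    ext i j
    have := hr i
    fin_cases j <;> simp [cubicContraction, Matrix.mul_apply, Fin.sum_univ_succ] <;>
      field_simp
    · ring
    · ring
    · linear_combination -this

end Forms

/-! ### Real and complex points of the twisted cubic -/

theorem cubicMonomials_ofReal (s t : ℝ) :
    cubicMonomials (s : ℂ) t = fun i => ((cubicMonomials s t i : ℝ) : ℂ) := by
  ext i
  fin_cases i <;> simp [cubicMonomials]

theorem toComplex_cubicContraction (a b : ℝ) :
    (cubicContraction a b).toComplex = cubicContraction (a : ℂ) b := by
  ext i j
  fin_cases i <;> fin_cases j <;> simp [cubicContraction]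

theorem toComplex_quarticContraction (a b : ℝ) :
    (quarticContraction a b).toComplex = quarticContraction (a : ℂ) b := by
  ext i j
  fin_cases i <;> fin_cases j <;> simp [quarticContraction]

theorem toComplex_quarticContractionQuadratic (k : Fin 3 → ℝ) :
    (quarticContractionQuadratic k).toComplex =
      quarticContractionQuadratic fun i => (k i : ℂ) := by
  ext i j
  fin_cases i <;> fin_cases j <;> simp [quarticContractionQuadratic]

/-- A real vector on the cone over the twisted cubic comes from real parameters. -/
theorem exists_real_cubicMonomials {v : Fin 4 → ℝ} {s t z : ℂ}
    (h : (fun i => (v i : ℂ)) = z • cubicMonomials s t) :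
    ∃ (a b c : ℝ), (a ≠ 0 ∨ b ≠ 0) ∧ v = c • cubicMonomials b (-a) := by
  have h0 := congrFun h 0
  have h1 := congrFun h 1
  have h2 := congrFun h 2
  have h3 := congrFun h 3
  simp [cubicMonomials] at h0 h1 h2 h3
  -- The quadrics cutting out the curve have real coefficients, so they hold for the real vector
  -- `v`; real parameters are then read off from `v`.
  have e01 : v 0 * v 2 = v 1 * v 1 := by
    have : (v 0 * v 2 : ℂ) = v 1 * v 1 := by rw [h0, h1, h2]; ring
    exact_mod_cast this
  have e12 : v 1 * v 3 = v 2 * v 2 := by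
    have : (v 1 * v 3 : ℂ) = v 2 * v 2 := by rw [h3, h1, h2]; ring
    exact_mod_cast this
  have e03 : v 0 * v 3 = v 1 * v 2 := by
    have : (v 0 * v 3 : ℂ) = v 1 * v 2 := by rw [h0, h1, h2, h3]; ring
    exact_mod_cast this
  by_cases hv0 : v 0 = 0
  · have hv1 : v 1 = 0 := by simpa [hv0] using e01.symm
    have hv2 : v 2 = 0 := by simpa [hv1] using e12.symm
    obtain ⟨c, hc⟩ := cubicContraction_mulVec_eq_zero (a := 1) (b := 0) (x := v) (by simp) (by
      ext i
      fin_cases i <;> simp [cubicContraction, Matrix.mulVec, dotProduct, Fin.sum_univ_succ, *])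
    exact ⟨1, 0, c, by simp, hc⟩
  · obtain ⟨c, hc⟩ := cubicContraction_mulVec_eq_zero (a := -v 1) (b := v 0) (x := v)
      (by simp [hv0]) (by
      ext i
      fin_cases i <;> simp [cubicContraction, Matrix.mulVec, dotProduct, Fin.sum_univ_succ] <;>
        linarith)
    exact ⟨-v 1, v 0, c, by simp [hv0], hc⟩

theorem Projectivization.map_submodule_mk_le_iff {P : Camera} {v : Fin 4 → ℂ} (hv : v ≠ 0)
    {u : Fin 3 → ℂ} (hu : u ≠ 0) :
    (Projectivization.mk ℂ v hv).submodule.map P.lin ≤ (Projectivization.mk ℂ u hu).submodule ↔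
      ∃ a : ℂ, a • u = P.mat.toComplex *ᵥ v := by
  rw [Projectivization.submodule_mk, Projectivization.submodule_mk, Submodule.map_span_le,
    ← Submodule.mem_span_singleton]
  simp [Camera.lin]

/-- The twisted cubic given by a real projective transformation. -/
def twistedCubic (M : GL (Fin 4) ℝ) : Set (ProjSpace 3) :=
  {x | ∃ s t : ℂ, ∃ h : ((M : Matrix (Fin 4) (Fin 4) ℝ).map ((↑) : ℝ → ℂ)).mulVec
    ![s ^ 3, s ^ 2 * t, s * t ^ 2, t ^ 3] ≠ 0, x = Projectivization.mk ℂ _ h}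

theorem toComplex_mulVec_ne_zero (M : GL (Fin 4) ℝ) {v : Fin 4 → ℂ} (hv : v ≠ 0) :
    M.val.toComplex *ᵥ v ≠ 0 := by
  intro h
  apply hv
  have h1 : (M⁻¹).val.toComplex *ᵥ (M.val.toComplex *ᵥ v) = v := by
    rw [Matrix.mulVec_mulVec, ← Matrix.toComplex_mul, ← Units.val_mul, inv_mul_cancel]
    simp [Matrix.toComplex]
  rw [← h1, h, Matrix.mulVec_zero]

theorem mk_mem_twistedCubic (M : GL (Fin 4) ℝ) {s t : ℂ} {v : Fin 4 → ℂ} (hv : v ≠ 0)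
    (h : v = M.val.toComplex *ᵥ cubicMonomials s t) :
    Projectivization.mk ℂ v hv ∈ twistedCubic M := by
  subst h
  exact ⟨s, t, hv, rfl⟩

/-! ### A criterion for nontrivial conjugates -/

namespace Configuration

/-- A criterion for the existence of a nontrivial conjugate with given cameras, in coordinates in
which the twisted cubic is the standard one: the epipoles have to change, and every point of the
twisted cubic needs a partner with a common image. -/
theorem exists_isNontrivialConjugate {A : Configuration 3} {M : GL (Fin 4) ℝ}
    (hX : A.points ⊆ twistedCubic M) {R : Fin 3 → Matrix (Fin 3) (Fin 4) ℝ}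
    (hR : ∀ i, R i = (A.camera i).mat * M.val) (Q : Fin 3 → Camera) {p q : Fin 3 → Fin 4 → ℝ}
    (hp : ∀ i, R i *ᵥ p i = 0) (hq : ∀ i, (Q i).mat *ᵥ q i = 0)
    (hqq : ∀ i j, i ≠ j → (Q i).mat *ᵥ q j ≠ 0)
    (hF : ∀ i j, i ≠ j → (∀ c : ℝ, R i *ᵥ p j ≠ c • (Q i).mat *ᵥ q j) ∨
      ∀ c : ℝ, R j *ᵥ p i ≠ c • (Q j).mat *ᵥ q i)
    (D : Set (ProjSpace 3))
    (hD : ∀ s t : ℂ, (s ≠ 0 ∨ t ≠ 0) → ∃ (y : Fin 4 → ℂ) (hy : y ≠ 0),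
      Projectivization.mk ℂ y hy ∈ D ∧ ∀ i, ∃ u : Fin 3 → ℂ, u ≠ 0 ∧
        (∃ a : ℂ, a • u = (R i).toComplex *ᵥ cubicMonomials s t) ∧
        ∃ b : ℂ, b • u = (Q i).mat.toComplex *ᵥ y) :
    ∃ B : Configuration 3, B.camera = Q ∧ B.points ⊆ D ∧ A.IsNontrivialConjugate B := by
  have hinj : Function.Injective fun i => (Q i).center := by
    intro i j hij
    by_contra hne
    exact Camera.center_ne_of_mulVec_ne_zero (hqq i j hne) (hq j) hij
  let common (x y : ProjSpace 3) : Set (Fin 3 → ProjSpace 2) :=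
    {u | u ∈ A.images x ∧ ∀ i, y.submodule.map (Q i).lin ≤ (u i).submodule}
  have hcommon : ∀ x ∈ A.points, ∃ y ∈ D, (common x y).Nonempty := by
    intro x hx
    obtain ⟨s, t, h, rfl⟩ := hX hx
    have hst : s ≠ 0 ∨ t ≠ 0 := by
      by_contra! h0
      apply h
      have := cubicMonomials_eq_zero.2 h0
      rw [cubicMonomials] at this
      rw [this, Matrix.mulVec_zero]
    obtain ⟨y, hy, hyD, hu⟩ := hD s t hst
    choose u hu0 hua hub using hu
    refine ⟨_, hyD, fun i => Projectivization.mk ℂ (u i) (hu0 i), fun i => ?_, fun i => ?_⟩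
    · rw [Projectivization.map_submodule_mk_le_iff]
      obtain ⟨a, ha⟩ := hua i
      refine ⟨a, ?_⟩
      rw [ha, hR, Matrix.toComplex_mul, ← Matrix.mulVec_mulVec]
      rfl
    · rw [Projectivization.map_submodule_mk_le_iff]
      exact hub i
  -- Only those points of `D` that share an image tuple with a point of `A` are kept, so both
  -- configurations reconstruct the set of shared tuples.
  let B : Configuration 3 := ⟨Q, hinj, {y | y ∈ D ∧ ∃ x ∈ A.points, (common x y).Nonempty}⟩
  have hp' (i : Fin 3) : (A.camera i).mat *ᵥ (M.val *ᵥ p i) = 0 := by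
    rw [Matrix.mulVec_mulVec, ← hR, hp]
  have hR' (i j : Fin 3) : (A.camera i).mat *ᵥ (M.val *ᵥ p j) = R i *ᵥ p j := by
    rw [Matrix.mulVec_mulVec, ← hR]
  have hq0 (j : Fin 3) : q j ≠ 0 := by
    intro h
    apply hqq (j + 1) j (by simp)
    rw [h, Matrix.mulVec_zero]
  refine ⟨B, rfl, fun y hy => hy.1, ⟨⟨{u | ∃ x ∈ A.points, ∃ y ∈ D, u ∈ common x y}, ⟨?_, ?_⟩,
    ?_, ?_⟩, fun h => ?_⟩, fun i j hij h => ?_⟩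
  · rintro u ⟨x, hx, y, hy, hu⟩
    exact ⟨x, hx, hu.1⟩
  · intro x hx
    obtain ⟨y, hy, u, hu⟩ := hcommon x hx
    exact ⟨u, ⟨x, hx, y, hy, hu⟩, hu.1⟩
  · rintro u ⟨x, hx, y, hy, hu⟩
    exact ⟨y, ⟨hy, x, hx, u, hu⟩, hu.2⟩
  · rintro y ⟨hy, x, hx, u, hu⟩
    exact ⟨u, ⟨x, hx, y, hy, hu⟩, hu.2⟩
  -- Equivalence would preserve all epipoles; the single pair of views 0, 1 already contradicts
  -- this.
  · have e (i j : Fin 3) : ∃ c : ℝ, R i *ᵥ p j = c • (Q i).mat *ᵥ q j := by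
      rw [← hR']
      exact h.epipole_eq_smul (hp' j) (hq0 j) (hq j)
    rcases hF 0 1 (by decide) with h' | h'
    · exact (e 0 1).elim h'
    · exact (e 1 0).elim h'
  · have e := Camera.epipoles_eq_smul h (hp' i) (hq i) (hqq j i hij.symm) (hp' j) (hq j)
      (hqq i j hij)
    rw [hR', hR'] at e
    rcases hF i j hij with h' | h'
    · exact e.1.elim h'
    · exact e.2.elim h'

end Configuration

/-! ### Coordinates adapted to the twisted cubic -/

theorem Fin.exists_fun_three {i j l : Fin 3} (hij : i ≠ j) (hil : i ≠ l) (hjl : j ≠ l)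
    {X : Type*} (x y z : X) : ∃ f : Fin 3 → X, f i = x ∧ f j = y ∧ f l = z :=
  ⟨fun m => if m = i then x else if m = j then y else z, by simp, by simp [hij.symm],
    by simp [hil.symm, hjl.symm]⟩

theorem Fin.forall_of_three {i j l : Fin 3} (hij : i ≠ j) (hil : i ≠ l) (hjl : j ≠ l)
    {P : Fin 3 → Prop} (hi : P i) (hj : P j) (hl : P l) (m : Fin 3) : P m := by
  have : m = i ∨ m = j ∨ m = l := by omega
  rcases this with rfl | rfl | rfl <;> assumption

theorem Matrix.exists_left_inverse_of_mul_surjective {n : ℕ} {G : Matrix (Fin 3) (Fin 3) ℝ}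
    {N : Matrix (Fin 3) (Fin n) ℝ} (h : Function.Surjective (G * N).mulVec) :
    ∃ G' : Matrix (Fin 3) (Fin 3) ℝ, G' * G = 1 := by
  obtain ⟨N', h'⟩ := Matrix.mulVec_surjective_iff_exists_right_inverse.1 h
  rw [Matrix.mul_assoc] at h'
  exact ⟨_, mul_eq_one_comm.1 h'⟩

theorem Matrix.mulVec_eq_zero_of_left_inverse {G G' : Matrix (Fin 3) (Fin 3) ℝ} (h : G' * G = 1)
    {v : Fin 3 → ℝ} : G *ᵥ v = 0 ↔ v = 0 := by
  refine ⟨fun h0 => ?_, fun h0 => by rw [h0, Matrix.mulVec_zero]⟩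
  rw [← Matrix.one_mulVec v, ← h, ← Matrix.mulVec_mulVec, h0, Matrix.mulVec_zero]

theorem Matrix.toComplex_mulVec_ne_zero_of_left_inverse {G G' : Matrix (Fin 3) (Fin 3) ℝ}
    (h : G' * G = 1) {v : Fin 3 → ℂ} (hv : v ≠ 0) : G.toComplex *ᵥ v ≠ 0 := by
  intro h0
  apply hv
  rw [← Matrix.one_mulVec v, show (1 : Matrix (Fin 3) (Fin 3) ℂ) = G'.toComplex * G.toComplex by
    rw [← Matrix.toComplex_mul, h]; simp [Matrix.toComplex], ← Matrix.mulVec_mulVec, h0,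
    Matrix.mulVec_zero]

theorem Matrix.mulVec_surjective_mul_of_left_inverse {n : ℕ} {G G' : Matrix (Fin 3) (Fin 3) ℝ}
    (h : G' * G = 1) {N : Matrix (Fin 3) (Fin n) ℝ} (hN : ∀ y, ∃ x, N *ᵥ x = y) :
    Function.Surjective (G * N).mulVec := by
  intro y
  obtain ⟨x, hx⟩ := hN (G' *ᵥ y)
  refine ⟨x, ?_⟩
  rw [← Matrix.mulVec_mulVec, hx, Matrix.mulVec_mulVec, mul_eq_one_comm.1 h,
    Matrix.one_mulVec]

namespace Configuration

/-- Camera matrices `R` and centers `p` of the configuration `A`, in coordinates in which the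
twisted cubic given by `M` is the standard one. -/
structure IsCoordinates (A : Configuration 3) (M : GL (Fin 4) ℝ)
    (R : Fin 3 → Matrix (Fin 3) (Fin 4) ℝ) (p : Fin 3 → Fin 4 → ℝ) : Prop where
  eq_mul : ∀ i, R i = (A.camera i).mat * M.val
  mulVec_self : ∀ i, R i *ᵥ p i = 0
  ne_zero : ∀ i, p i ≠ 0

theorem exists_isCoordinates (A : Configuration 3) (M : GL (Fin 4) ℝ) :
    ∃ R p, A.IsCoordinates M R p := by
  choose v hv0 hv using fun i => (A.camera i).exists_real_ker
  refine ⟨fun i => (A.camera i).mat * M.val, fun i => (M⁻¹).val *ᵥ v i, fun i => rfl, fun i => ?_,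
    fun i h0 => hv0 i ?_⟩
  · rw [Matrix.mulVec_mulVec, Matrix.mul_assoc, ← Units.val_mul, mul_inv_cancel]
    simpa using hv i
  · have : M.val *ᵥ ((M⁻¹).val *ᵥ v i) = v i := by
      rw [Matrix.mulVec_mulVec, ← Units.val_mul, mul_inv_cancel]
      simp
    rw [← this, h0, Matrix.mulVec_zero]

namespace IsCoordinates

variable {A : Configuration 3} {M : GL (Fin 4) ℝ} {R : Fin 3 → Matrix (Fin 3) (Fin 4) ℝ}
  {p : Fin 3 → Fin 4 → ℝ} (h : A.IsCoordinates M R p)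

theorem inv_mulVec_mulVec (M : GL (Fin 4) ℝ) (v : Fin 4 → ℝ) : (M⁻¹).val *ᵥ (M.val *ᵥ v) = v := by
  rw [Matrix.mulVec_mulVec, ← Units.val_mul, inv_mul_cancel]
  simp

theorem mulVec_ne_zero (M : GL (Fin 4) ℝ) {v : Fin 4 → ℝ} (hv : v ≠ 0) : M.val *ᵥ v ≠ 0 := by
  intro h0
  apply hv
  rw [← inv_mulVec_mulVec M v, h0, Matrix.mulVec_zero]

include h

theorem camera_mulVec (i : Fin 3) (v : Fin 4 → ℝ) :
    (A.camera i).mat *ᵥ (M.val *ᵥ v) = R i *ᵥ v := by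
  rw [h.eq_mul, Matrix.mulVec_mulVec]

theorem eq_smul {i : Fin 3} {v : Fin 4 → ℝ} (hv : R i *ᵥ v = 0) : ∃ c : ℝ, v = c • p i := by
  obtain ⟨c, hc⟩ := (A.camera i).eq_smul_of_mulVec_eq_zero (v := M.val *ᵥ p i) (w := M.val *ᵥ v)
    (mulVec_ne_zero M (h.ne_zero i)) (by rw [h.camera_mulVec, h.mulVec_self])
    (by rw [h.camera_mulVec, hv])
  refine ⟨c, ?_⟩
  rw [← inv_mulVec_mulVec M v, hc, Matrix.mulVec_smul, inv_mulVec_mulVec]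

theorem mulVec_center_ne_zero {i j : Fin 3} (hij : i ≠ j) : R i *ᵥ p j ≠ 0 := by
  rw [← h.camera_mulVec]
  refine Camera.mulVec_ne_zero_of_center_ne (Q := A.camera j) (fun hc => hij (A.distinct hc))
    (mulVec_ne_zero M (h.ne_zero j)) ?_
  rw [h.camera_mulVec, h.mulVec_self]

theorem surjective (i : Fin 3) : Function.Surjective (R i).mulVec := by
  intro y
  obtain ⟨x, hx⟩ := (A.camera i).mulVec_surjective y
  refine ⟨(M⁻¹).val *ᵥ x, ?_⟩
  rw [← h.camera_mulVec, Matrix.mulVec_mulVec x M.val, ← Units.val_mul, mul_inv_cancel]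
  simpa using hx

theorem center_eq_mk (i : Fin 3) : A.center i = Projectivization.mk ℂ
    (M.val.toComplex *ᵥ fun k => (p i k : ℂ))
    (toComplex_mulVec_ne_zero M (ofReal_comp_ne_zero (h.ne_zero i))) := by
  apply Camera.center_eq_mk
  rw [Matrix.mulVec_mulVec, ← Matrix.toComplex_mul, ← h.eq_mul, toComplex_mulVec_ofReal,
    h.mulVec_self]
  ext
  simp

theorem exists_eq_smul_cubicMonomials {i : Fin 3} (hi : A.center i ∈ twistedCubic M) :
    ∃ (a b c : ℝ), (a ≠ 0 ∨ b ≠ 0) ∧ p i = c • cubicMonomials b (-a) := by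
  obtain ⟨s, t, hst, heq⟩ := hi
  rw [h.center_eq_mk, Projectivization.mk_eq_mk_iff'] at heq
  obtain ⟨z, hz⟩ := heq
  refine exists_real_cubicMonomials (s := s) (t := t) (z := z) ?_
  by_contra hne
  apply toComplex_mulVec_ne_zero M (sub_ne_zero.2 hne)
  rw [Matrix.mulVec_sub, Matrix.mulVec_smul, ← hz]
  simp [cubicMonomials]

theorem center_mem_twistedCubic {i : Fin 3} {s t : ℂ} (hst : s ≠ 0 ∨ t ≠ 0)
    (hR : (R i).toComplex *ᵥ cubicMonomials s t = 0) : A.center i ∈ twistedCubic M := by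
  have h0 : cubicMonomials s t ≠ 0 := by
    rw [Ne, cubicMonomials_eq_zero]
    tauto
  rw [center, Camera.center_eq_mk (v := M.val.toComplex *ᵥ cubicMonomials s t) _
    (toComplex_mulVec_ne_zero M h0)]
  · exact mk_mem_twistedCubic M _ rfl
  · rw [Matrix.mulVec_mulVec, ← Matrix.toComplex_mul, ← h.eq_mul, hR]

/-- The camera with center on the twisted cubic factors through the projection from that point. -/
theorem exists_eq_mul {i : Fin 3} (hi : A.center i ∈ twistedCubic M) :
    ∃ (a b c : ℝ) (G G' : Matrix (Fin 3) (Fin 3) ℝ), (a ≠ 0 ∨ b ≠ 0) ∧ G' * G = 1 ∧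
      R i = G * cubicContraction a b ∧ c ≠ 0 ∧ p i = c • cubicMonomials b (-a) := by
  obtain ⟨a, b, c, hab, hp⟩ := h.exists_eq_smul_cubicMonomials hi
  have hc : c ≠ 0 := by
    rintro rfl
    exact h.ne_zero i (by rw [hp, zero_smul])
  have h0 := h.mulVec_self i
  rw [hp, Matrix.mulVec_smul, smul_eq_zero, or_iff_right hc] at h0
  obtain ⟨G, hG⟩ := exists_eq_mul_cubicContraction hab h0
  obtain ⟨G', hG'⟩ := Matrix.exists_left_inverse_of_mul_surjective (hG ▸ h.surjective i)
  exact ⟨a, b, c, G, G', hab, hG', hG, hc, hp⟩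

/-- The criterion for three cameras in an arbitrary order `i`, `j`, `l`, which play different roles
in the applications. One epipole is compared per pair, and the new points are not confined to a
prescribed set. -/
theorem isCritical_of_cameras (hX : A.points ⊆ twistedCubic M) {i j l : Fin 3} (hij : i ≠ j)
    (hil : i ≠ l) (hjl : j ≠ l) {P Q S : Matrix (Fin 3) (Fin 4) ℝ}
    (hP : Function.Surjective P.mulVec) (hQ : Function.Surjective Q.mulVec)
    (hS : Function.Surjective S.mulVec)
    {u v w : Fin 4 → ℝ} (hPu : P *ᵥ u = 0) (hQv : Q *ᵥ v = 0) (hSw : S *ᵥ w = 0)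
    (hPv : P *ᵥ v ≠ 0) (hPw : P *ᵥ w ≠ 0) (hQu : Q *ᵥ u ≠ 0) (hQw : Q *ᵥ w ≠ 0)
    (hSu : S *ᵥ u ≠ 0) (hSv : S *ᵥ v ≠ 0)
    (eij : ∀ c : ℝ, R i *ᵥ p j ≠ c • P *ᵥ v) (eil : ∀ c : ℝ, R i *ᵥ p l ≠ c • P *ᵥ w)
    (ejl : ∀ c : ℝ, R j *ᵥ p l ≠ c • Q *ᵥ w)
    (hD : ∀ s t : ℂ, (s ≠ 0 ∨ t ≠ 0) → ∃ (y : Fin 4 → ℂ), y ≠ 0 ∧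
      (∃ u : Fin 3 → ℂ, u ≠ 0 ∧ (∃ a : ℂ, a • u = (R i).toComplex *ᵥ cubicMonomials s t) ∧
        ∃ b : ℂ, b • u = P.toComplex *ᵥ y) ∧
      (∃ u : Fin 3 → ℂ, u ≠ 0 ∧ (∃ a : ℂ, a • u = (R j).toComplex *ᵥ cubicMonomials s t) ∧
        ∃ b : ℂ, b • u = Q.toComplex *ᵥ y) ∧
      (∃ u : Fin 3 → ℂ, u ≠ 0 ∧ (∃ a : ℂ, a • u = (R l).toComplex *ᵥ cubicMonomials s t) ∧
        ∃ b : ℂ, b • u = S.toComplex *ᵥ y)) : A.IsCritical := by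
  obtain ⟨C, hCi, hCj, hCl⟩ := Fin.exists_fun_three hij hil hjl (Camera.ofSurjective P hP)
    (Camera.ofSurjective Q hQ) (Camera.ofSurjective S hS)
  obtain ⟨q, hqi, hqj, hql⟩ := Fin.exists_fun_three hij hil hjl u v w
  have hCi' : (C i).mat = P := by rw [hCi]; rfl
  have hCj' : (C j).mat = Q := by rw [hCj]; rfl
  have hCl' : (C l).mat = S := by rw [hCl]; rfl
  have all {P : Fin 3 → Prop} (hi : P i) (hj : P j) (hl : P l) := 
    Fin.forall_of_three hij hil hjl hi hj hl
  obtain ⟨B, -, -, hB⟩ := exists_isNontrivialConjugate hX h.eq_mul C (p := p) (q := q)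
    h.mulVec_self (all (by rwa [hCi', hqi]) (by rwa [hCj', hqj]) (by rwa [hCl', hql]))
    (all
      (all (absurd rfl) (by rw [hCi', hqj]; tauto) (by rw [hCi', hql]; tauto))
      (all (by rw [hCj', hqi]; tauto) (absurd rfl) (by rw [hCj', hql]; tauto))
      (all (by rw [hCl', hqi]; tauto) (by rw [hCl', hqj]; tauto) (absurd rfl)))
    (all
      (all (absurd rfl) (by rw [hCi', hqj]; tauto) (by rw [hCi', hql]; tauto))
      (all (by rw [hCi', hqj]; tauto) (absurd rfl) (by rw [hCj', hql]; tauto))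
      (all (by rw [hCi', hql]; tauto) (by rw [hCj', hql]; tauto) (absurd rfl)))
    Set.univ (by
      intro s t hst
      obtain ⟨y, hy, hi, hj, hl⟩ := hD s t hst
      exact ⟨y, hy, Set.mem_univ _,
        all (by rwa [hCi']) (by rwa [hCj']) (by rwa [hCl'])⟩)
  exact ⟨B, hB⟩

end IsCoordinates

end Configuration

/-! ### Two or three centers on the cubic -/

/-- Otherwise a nonzero polynomial of degree at most 3 would have infinitely many roots. The
excluded set serves to choose a second parameter different from the first. -/
theorem exists_cubicMonomials_dotProduct_ne_zero {f : Fin 4 → ℝ} (hf : f ≠ 0) {s : Set ℝ}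
    (hs : s.Finite) : ∃ θ ∉ s, cubicMonomials 1 θ ⬝ᵥ f ≠ 0 := by
  by_contra! hc
  let g : Polynomial ℝ := Polynomial.C (f 0) + Polynomial.C (f 1) * Polynomial.X +
    Polynomial.C (f 2) * Polynomial.X ^ 2 + Polynomial.C (f 3) * Polynomial.X ^ 3
  have hg : g = 0 := by
    apply Polynomial.eq_zero_of_infinite_isRoot
    refine Set.Infinite.mono (fun θ hθ => ?_) hs.infinite_compl
    have := hc θ hθ
    simp only [cubicMonomials, dotProduct, Fin.sum_univ_four] at this
    simp [Polynomial.IsRoot, g]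
    simp at this
    linear_combination this
  apply hf
  have hcoeff (n : ℕ) : g.coeff n = 0 := by rw [hg, Polynomial.coeff_zero]
  have h0 := hcoeff 0
  have h1 := hcoeff 1
  have h2 := hcoeff 2
  have h3 := hcoeff 3
  simp [g, Polynomial.coeff_X, Polynomial.coeff_C, Polynomial.coeff_X_pow] at h0 h1 h2 h3
  ext i
  fin_cases i <;> assumption

namespace Configuration.IsCoordinates

variable {A : Configuration 3} {M : GL (Fin 4) ℝ} {R : Fin 3 → Matrix (Fin 3) (Fin 4) ℝ}
  {p : Fin 3 → Fin 4 → ℝ}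

/-- Three cameras with centers on the twisted cubic: there is a conjugate on a plane conic. -/
theorem exists_conjugate_conic (h : A.IsCoordinates M R p) (hX : A.points ⊆ twistedCubic M)
    (hc : ∀ i, A.center i ∈ twistedCubic M) :
    ∃ B : Configuration 3, A.IsNontrivialConjugate B ∧
      ∃ D, IsConic D ∧ B.points ⊆ D ∧ ∀ i, B.center i ∉ D := by
  choose a b c G G' hab hG hR hc0 hp using fun i => h.exists_eq_mul (hc i)
  -- Projection from (0, r, 0, 1) that is the identity on the plane where the last coordinate
  -- vanishes. The values r = 0, 1, 2 give distinct centers on a line whose trace on the plane, (0,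
  -- 1, 0), is off the conic.
  let E (r : ℝ) : Matrix (Fin 3) (Fin 4) ℝ := !![1, 0, 0, 0; 0, 1, 0, -r; 0, 0, 1, 0]
  have hE (r : ℝ) (y : Fin 3 → ℝ) : ∃ x, E r *ᵥ x = y := by
    refine ⟨![y 0, y 1, y 2, 0], ?_⟩
    ext i
    fin_cases i <;> simp [E, Matrix.mulVec, dotProduct, Fin.sum_univ_succ]
  have hEv (r r' : ℝ) : E r *ᵥ ![0, r', 0, 1] = ![0, r' - r, 0] := by
    ext i
    fin_cases i <;> simp [E, Matrix.mulVec, dotProduct, Fin.sum_univ_succ, sub_eq_add_neg]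
  let N : Matrix (Fin 4) (Fin 3) ℝ := !![1, 0, 0; 0, 1, 0; 0, 0, 1; 0, 0, 0]
  have hN (v : Fin 3 → ℂ) : N.toComplex *ᵥ v = ![v 0, v 1, v 2, 0] := by
    ext i
    fin_cases i <;> simp [N, Matrix.mulVec, dotProduct, Fin.sum_univ_succ]
  have hEN (r : ℝ) (v : Fin 3 → ℂ) : (E r).toComplex *ᵥ (N.toComplex *ᵥ v) = v := by
    rw [hN]
    ext i
    fin_cases i <;> simp [E, Matrix.mulVec, dotProduct, Fin.sum_univ_succ]
  let Q (i : Fin 3) : Camera := Camera.ofSurjective (G i * E (i : ℕ))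
    (Matrix.mulVec_surjective_mul_of_left_inverse (hG i) (hE _))
  have hQ (i j : Fin 3) : (Q i).mat *ᵥ ![0, ((j : ℕ) : ℝ), 0, 1] =
      G i *ᵥ ![0, ((j : ℕ) : ℝ) - (i : ℕ), 0] := by
    rw [← hEv, Matrix.mulVec_mulVec]
    rfl
  have hQ0 (i : Fin 3) : (Q i).mat *ᵥ ![0, ((i : ℕ) : ℝ), 0, 1] = 0 := by
    rw [hQ, Matrix.mulVec_eq_zero_of_left_inverse (hG i)]
    ext k
    fin_cases k <;> simp
  let D : Set (ProjSpace 3) := {x | ∃ s t : ℂ, ∃ h : (N.map ((↑) : ℝ → ℂ)).mulVec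
    ![s ^ 2, s * t, t ^ 2] ≠ 0, x = Projectivization.mk ℂ _ h}
  obtain ⟨B, hBQ, hBD, hB⟩ := exists_isNontrivialConjugate hX h.eq_mul Q (p := p)
    (q := fun j => ![0, ((j : ℕ) : ℝ), 0, 1]) h.mulVec_self hQ0
    (fun i j hij h0 => by
      rw [hQ, Matrix.mulVec_eq_zero_of_left_inverse (hG i)] at h0
      have h1 := congrFun h0 1
      simp [sub_eq_zero] at h1
      omega)
    -- Up to `G i`, the old epipole is a point of the conic, the new one is (0, j - i, 0); a conic
    -- point with first and last coordinates zero would be zero.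
    (fun i j hij => Or.inl fun z hz => by
      have hne := h.mulVec_center_ne_zero hij
      rw [hQ, hR, ← Matrix.mulVec_mulVec, ← Matrix.mulVec_smul, ← sub_eq_zero, ← Matrix.mulVec_sub,
        Matrix.mulVec_eq_zero_of_left_inverse (hG i), sub_eq_zero, hp, Matrix.mulVec_smul,
        cubicContraction_mulVec_cubicMonomials, smul_smul] at hz
      rw [hR, ← Matrix.mulVec_mulVec, hp, Matrix.mulVec_smul,
        cubicContraction_mulVec_cubicMonomials, smul_smul] at hne
      have h0 := congrFun hz 0
      have h2 := congrFun hz 2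
      generalize c j * (a i * b j + b i * -a j) = d at *
      have hd : d ≠ 0 := by
        rintro rfl
        simp at hne
      simp [quadraticMonomials, hd] at h0 h2
      have := hab j
      tauto)
    D (fun s t hst => by
      have hcon : quadraticMonomials s t ≠ 0 := by
        rw [Ne, quadraticMonomials_eq_zero]
        tauto
      have hy : N.toComplex *ᵥ quadraticMonomials s t ≠ 0 := by
        intro h0
        apply hcon
        rw [← hEN 0 (quadraticMonomials s t), h0, Matrix.mulVec_zero]
      refine ⟨_, hy, ⟨s, t, hy, rfl⟩, fun i => ⟨(G i).toComplex *ᵥ quadraticMonomials s t,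
        Matrix.toComplex_mulVec_ne_zero_of_left_inverse (hG i) hcon, ⟨a i * s + b i * t, ?_⟩,
        1, ?_⟩⟩
      · rw [hR, Matrix.toComplex_mul, ← Matrix.mulVec_mulVec, toComplex_cubicContraction,
          cubicContraction_mulVec_cubicMonomials, Matrix.mulVec_smul]
      · change _ = (G i * E (i : ℕ)).toComplex *ᵥ _
        rw [Matrix.toComplex_mul, ← Matrix.mulVec_mulVec, hEN, one_smul])
  refine ⟨B, hB, D, ⟨N, ?_, rfl⟩, hBD, ?_⟩
  · apply le_antisymm
    · simpa using N.rank_le_width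
    · have hmul : E 0 * N = 1 := by
        ext i j
        fin_cases i <;> fin_cases j <;> simp [E, N, Matrix.mul_apply, Fin.sum_univ_succ]
      have := Matrix.rank_mul_le_right (E 0) N
      rw [hmul, Matrix.rank_one] at this
      simpa using this
  · rintro i ⟨s, t, hst, heq⟩
    have hv : (![0, ((i : ℕ) : ℝ), 0, 1] : Fin 4 → ℝ) ≠ 0 := by
      intro h0
      simpa using congrFun h0 3
    rw [center, hBQ, Camera.center_eq_mk _ (ofReal_comp_ne_zero hv)
      (by rw [toComplex_mulVec_ofReal, hQ0]; ext; simp), Projectivization.mk_eq_mk_iff'] at heq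
    obtain ⟨z, hz⟩ := heq
    have h3 := congrFun hz 3
    rw [Pi.smul_apply, hN] at h3
    simp at h3

/-- Two cameras with centers on the twisted cubic: these centers can be moved along it. -/
theorem isCritical_of_two_mem (h : A.IsCoordinates M R p) (hX : A.points ⊆ twistedCubic M)
    {l i j : Fin 3} (hli : l ≠ i) (hlj : l ≠ j) (hij : i ≠ j) (hi : A.center i ∈ twistedCubic M)
    (hj : A.center j ∈ twistedCubic M) : A.IsCritical := by
  obtain ⟨ai, bi, ci, Gi, Gi', habi, hGi, hRi, hci, hpi⟩ := h.exists_eq_mul hi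
  obtain ⟨aj, bj, cj, Gj, Gj', habj, hGj, hRj, hcj, hpj⟩ := h.exists_eq_mul hj
  -- `f` and `g` are planes through the fixed center and one moving center. A new center off the
  -- plane is not collinear with these two, so its epipole in view `l` changes.
  obtain ⟨f, hf0, hf⟩ := exists_dotProduct_eq_zero 2 (by norm_num) ![p l, p i]
  obtain ⟨g, hg0, hg⟩ := exists_dotProduct_eq_zero 2 (by norm_num) ![p l, p j]
  obtain ⟨θ, -, hθ⟩ := exists_cubicMonomials_dotProduct_ne_zero hf0 Set.finite_empty
  obtain ⟨η, hηθ, hη⟩ := exists_cubicMonomials_dotProduct_ne_zero hg0 (Set.finite_singleton θ)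
  have key {f : Fin 4 → ℝ} {θ : ℝ} (hθ : cubicMonomials 1 θ ⬝ᵥ f ≠ 0) (hl : p l ⬝ᵥ f = 0) :
      R l *ᵥ cubicMonomials 1 θ ≠ 0 ∧ cubicContraction (-θ) 1 *ᵥ p l ≠ 0 ∧
      ∀ m, l ≠ m → p m ⬝ᵥ f = 0 → ∀ c : ℝ, R l *ᵥ p m ≠ c • R l *ᵥ cubicMonomials 1 θ := by
    refine ⟨fun h0 => ?_, fun h0 => ?_, fun m hlm hm c hc => ?_⟩
    · obtain ⟨c, hc⟩ := h.eq_smul h0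
      apply hθ
      rw [hc, smul_dotProduct, hl, smul_zero]
    · obtain ⟨c, hc⟩ := cubicContraction_mulVec_eq_zero (by simp) h0
      rw [neg_neg] at hc
      rw [hc, smul_dotProduct, smul_eq_mul, mul_eq_zero, or_iff_left hθ] at hl
      apply h.ne_zero l
      rw [hc, hl, zero_smul]
    · rw [← Matrix.mulVec_smul, ← sub_eq_zero, ← Matrix.mulVec_sub] at hc
      obtain ⟨d, hd⟩ := h.eq_smul hc
      have h1 := congrArg (· ⬝ᵥ f) hd
      simp only [sub_dotProduct, smul_dotProduct, hm, hl, smul_eq_mul, mul_zero, zero_sub,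
        neg_eq_zero, mul_eq_zero, hθ, or_false] at h1
      apply h.mulVec_center_ne_zero hlm
      rw [h1, zero_smul, sub_zero] at hd
      rw [hd, Matrix.mulVec_smul, h.mulVec_self, smul_zero]
  obtain ⟨k1, k2, k3⟩ := key hθ (hf 0)
  obtain ⟨k1', k2', k3'⟩ := key hη (hg 0)
  have mul_cub (G : Matrix (Fin 3) (Fin 3) ℝ) (a b s t : ℝ) :
      (G * cubicContraction a b) *ᵥ cubicMonomials s t =
        (a * s + b * t) • G *ᵥ quadraticMonomials s t := by
    rw [← Matrix.mulVec_mulVec, cubicContraction_mulVec_cubicMonomials, Matrix.mulVec_smul]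
  have mul_cub' (G : Matrix (Fin 3) (Fin 3) ℝ) (a b : ℝ) (s t : ℂ) :
      (G * cubicContraction a b).toComplex *ᵥ cubicMonomials s t =
        (a * s + b * t) • G.toComplex *ᵥ quadraticMonomials s t := by
    rw [Matrix.toComplex_mul, toComplex_cubicContraction, ← Matrix.mulVec_mulVec,
      cubicContraction_mulVec_cubicMonomials, Matrix.mulVec_smul]
  have hq1 (θ : ℝ) : quadraticMonomials 1 θ ≠ 0 := by simp [quadraticMonomials_eq_zero]
  have hηθ' : η ≠ θ := hηθ
  refine h.isCritical_of_cameras hX hli hlj hij (P := R l) (Q := Gi * cubicContraction (-θ) 1)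
    (S := Gj * cubicContraction (-η) 1) (u := p l) (v := cubicMonomials 1 θ)
    (w := cubicMonomials 1 η) (h.surjective l)
    (Matrix.mulVec_surjective_mul_of_left_inverse hGi
      (exists_cubicContraction_mulVec_eq (by simp)))
    (Matrix.mulVec_surjective_mul_of_left_inverse hGj
      (exists_cubicContraction_mulVec_eq (by simp))) (h.mulVec_self l) ?_ ?_ k1 k1' ?_ ?_ ?_ ?_
      (k3 i hli (hf 1)) (k3' j hlj (hg 1)) ?_ ?_
  · rw [mul_cub]
    simp
  · rw [mul_cub]
    simp
  · rwa [← Matrix.mulVec_mulVec, Ne, Matrix.mulVec_eq_zero_of_left_inverse hGi]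
  · rw [mul_cub, Ne, smul_eq_zero, Matrix.mulVec_eq_zero_of_left_inverse hGi,
      or_iff_left (hq1 _)]
    intro h0
    apply hηθ'
    linarith
  · rwa [← Matrix.mulVec_mulVec, Ne, Matrix.mulVec_eq_zero_of_left_inverse hGj]
  · rw [mul_cub, Ne, smul_eq_zero, Matrix.mulVec_eq_zero_of_left_inverse hGj,
      or_iff_left (hq1 _)]
    intro h0
    apply hηθ'
    linarith
  -- Up to `Gi`, the old and new epipoles are conic points. If they agreed, the old center of `j`
  -- would have parameter (1, η), but it lies in the plane `g` and the new center does not.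
  · intro c hc
    have hne := h.mulVec_center_ne_zero hij
    rw [mul_cub, hRi, hpj, Matrix.mulVec_smul, mul_cub, smul_smul, smul_smul, ← Matrix.mulVec_smul,
      ← Matrix.mulVec_smul, ← sub_eq_zero, ← Matrix.mulVec_sub,
      Matrix.mulVec_eq_zero_of_left_inverse hGi, sub_eq_zero] at hc
    rw [hRi, hpj, Matrix.mulVec_smul, mul_cub, smul_smul] at hne
    generalize cj * (ai * bj + bi * -aj) = d at *
    generalize c * (-θ * 1 + 1 * η) = e at *
    have hd : d ≠ 0 := by
      rintro rfl
      simp at hne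
    have h0 := congrFun hc 0
    have h1 := congrFun hc 1
    have h2 := congrFun hc 2
    simp [quadraticMonomials] at h0 h1 h2
    have hbj : bj ≠ 0 := by
      rintro rfl
      have : aj ≠ 0 := by tauto
      have he : e = 0 := by simpa using h0.symm
      simp [he, hd, this] at h2
    have haj : -aj = η * bj := by
      have : d * bj * (-aj - η * bj) = 0 := by linear_combination h1 - η * h0
      have := (mul_eq_zero.1 this).resolve_left (mul_ne_zero hd hbj)
      linarith
    have e1 : cubicMonomials bj (-aj) = bj ^ 3 • cubicMonomials 1 η := by
      rw [haj]
      ext i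
      fin_cases i <;> simp [cubicMonomials] <;> ring
    have h3 : p j ⬝ᵥ g = 0 := hg 1
    rw [hpj, e1, smul_dotProduct, smul_dotProduct] at h3
    simp [hcj, hbj, hη] at h3
  · intro s t hst
    have hcub : cubicMonomials s t ≠ 0 := by
      rw [Ne, cubicMonomials_eq_zero]
      tauto
    have hcon : quadraticMonomials s t ≠ 0 := by
      rw [Ne, quadraticMonomials_eq_zero]
      tauto
    refine ⟨cubicMonomials s t, hcub, ?_, ⟨Gi.toComplex *ᵥ quadraticMonomials s t,
        Matrix.toComplex_mulVec_ne_zero_of_left_inverse hGi hcon, ⟨ai * s + bi * t, ?_⟩,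
        ⟨-θ * s + t, ?_⟩⟩, ⟨Gj.toComplex *ᵥ quadraticMonomials s t,
        Matrix.toComplex_mulVec_ne_zero_of_left_inverse hGj hcon, ⟨aj * s + bj * t, ?_⟩,
        ⟨-η * s + t, ?_⟩⟩⟩
    -- If the curve point is the center of the unmoved camera, its image is arbitrary and any
    -- nonzero vector serves.
    · by_cases h0 : (R l).toComplex *ᵥ cubicMonomials s t = 0
      · exact ⟨quadraticMonomials s t, hcon, ⟨0, by rw [h0, zero_smul]⟩, 0, by rw [h0, zero_smul]⟩
      · exact ⟨_, h0, ⟨1, one_smul _ _⟩, 1, one_smul _ _⟩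
    · rw [hRi, mul_cub']
    · rw [mul_cub']
      simp
    · rw [hRj, mul_cub']
    · rw [mul_cub']
      simp

end Configuration.IsCoordinates

/-! ### Secants of the cubic and of the rational normal quartic -/

theorem exists_cubicContractionQuadratic_mulVec_eq {k : Fin 3 → ℝ} (h : k ≠ 0) (y : Fin 2 → ℝ) :
    ∃ x, cubicContractionQuadratic k *ᵥ x = y := by
  by_cases h0 : k 0 = 0
  · by_cases h1 : k 1 = 0
    · have h2 : k 2 ≠ 0 := by
        intro h2
        apply h
        ext i
        fin_cases i <;> assumption
      refine ⟨![0, 0, y 0 / k 2, y 1 / k 2], ?_⟩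
      ext i
      fin_cases i <;> simp [cubicContractionQuadratic, Matrix.mulVec, dotProduct,
        Fin.sum_univ_succ, h0, h1] <;> field_simp
    · refine ⟨![0, (y 0 - k 2 * (y 1 / k 1)) / k 1, y 1 / k 1, 0], ?_⟩
      ext i
      fin_cases i <;> simp [cubicContractionQuadratic, Matrix.mulVec, dotProduct,
        Fin.sum_univ_succ, h0] <;> field_simp
      ring
  · refine ⟨![(y 0 - k 1 * (y 1 / k 0)) / k 0, y 1 / k 0, 0, 0], ?_⟩
    ext i
    fin_cases i <;> simp [cubicContractionQuadratic, Matrix.mulVec, dotProduct,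
      Fin.sum_univ_succ] <;> field_simp
    ring

/-- This kernel is the line in ℙ³ attached to `k`: the secant through the zeros of `k`, real or
conjugate, or a tangent if they coincide. -/
theorem finrank_ker_cubicContractionQuadratic {k : Fin 3 → ℝ} (h : k ≠ 0) :
    Module.finrank ℝ (LinearMap.ker (cubicContractionQuadratic k).mulVecLin) = 2 := by
  have hdim := (cubicContractionQuadratic k).mulVecLin.finrank_range_add_finrank_ker
  have hs : Function.Surjective (cubicContractionQuadratic k).mulVecLin :=
    exists_cubicContractionQuadratic_mulVec_eq h
  rw [LinearMap.range_eq_top.2 hs] at hdim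
  simp only [finrank_top, Module.finrank_fin_fun] at hdim
  omega

theorem exists_quadratic_ne_zero {k : Fin 3 → ℝ} (h : k ≠ 0) :
    ∃ τ, k 0 * τ ^ 2 + k 1 * τ + k 2 ≠ 0 := by
  by_contra! hc
  have e0 := hc 0
  have e1 := hc 1
  have e2 := hc (-1)
  apply h
  ext i
  fin_cases i <;> simp <;> linarith

/-- Two points of a secant line of the twisted cubic are contractions of one point of the
corresponding secant line of the rational normal quartic by linear forms. -/
theorem exists_quarticContraction_eq {k : Fin 3 → ℝ} (hk : k ≠ 0) {p r : Fin 4 → ℝ}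
    (hkp : cubicContractionQuadratic k *ᵥ p = 0) (hkr : cubicContractionQuadratic k *ᵥ r = 0)
    (hp : ∀ a b c : ℝ, (a ≠ 0 ∨ b ≠ 0) → p ≠ c • cubicMonomials b (-a)) :
    ∃ (w : Fin 5 → ℝ) (a b c d : ℝ), quarticContractionQuadratic k *ᵥ w = 0 ∧
      quarticContraction a b *ᵥ w = p ∧ quarticContraction c d *ᵥ w = r := by
  obtain ⟨τ, hτ⟩ := exists_quadratic_ne_zero hk
  have e0 := congrFun hkp 0
  have e1 := congrFun hkp 1
  simp [cubicContractionQuadratic, Matrix.mulVec, dotProduct, Fin.sum_univ_succ] at e0 e1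
  -- Since k(τ, 1) ≠ 0, the form s - τt does not divide `k`, so contraction with it is invertible
  -- between the kernels of contraction with `k`; `w` is k(τ, 1) times the preimage of `p`.
  let w : Fin 5 → ℝ := ![(k 2 + τ * k 1) * p 0 + τ * k 2 * p 1, k 2 * p 1 - τ * k 0 * p 0,
    k 2 * p 2 - τ * k 0 * p 1, k 2 * p 3 - τ * k 0 * p 2, -k 0 * p 2 - (k 1 + τ * k 0) * p 3]
  have hw : quarticContraction 1 (-τ) *ᵥ w = (k 0 * τ ^ 2 + k 1 * τ + k 2) • p := by
    ext i
    fin_cases i <;> simp [quarticContraction, Matrix.mulVec, dotProduct, Fin.sum_univ_succ, w]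
    · ring
    · linear_combination (-τ) * e0
    · linear_combination (-τ) * e1
    · ring
  have hkw : quarticContractionQuadratic k *ᵥ w = 0 := by
    ext i
    fin_cases i <;>
      simp [quarticContractionQuadratic, Matrix.mulVec, dotProduct, Fin.sum_univ_succ, w]
    · linear_combination k 2 * e0
    · linear_combination k 2 * e1 - τ * k 0 * e0
    · linear_combination (-τ * k 0) * e1
  have split (v : Fin 5 → ℝ) (a b : ℝ) : quarticContraction a b *ᵥ v =
      a • quarticContraction 1 0 *ᵥ v + b • quarticContraction 0 1 *ᵥ v := by
    ext i
    fin_cases i <;> simp [quarticContraction, Matrix.mulVec, dotProduct, Fin.sum_univ_succ]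
  have hker (v : Fin 5 → ℝ) (hv : quarticContractionQuadratic k *ᵥ v = 0) (a b : ℝ) :
      cubicContractionQuadratic k *ᵥ quarticContraction a b *ᵥ v = 0 := by
    have h0 := congrFun hv 0
    have h1 := congrFun hv 1
    have h2 := congrFun hv 2
    simp [quarticContractionQuadratic, Matrix.mulVec, dotProduct, Fin.sum_univ_succ] at h0 h1 h2
    ext i
    fin_cases i <;> simp [cubicContractionQuadratic, quarticContraction, Matrix.mulVec,
      dotProduct, Fin.sum_univ_succ]
    · linear_combination a * h0 + b * h1
    · linear_combination a * h1 + b * h2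
  -- Contractions commute, so a nonzero linear form killing `w` would kill `p` and put it on the
  -- cubic.
  have hind (a b : ℝ) (hab : quarticContraction a b *ᵥ w = 0) : a = 0 ∧ b = 0 := by
    by_contra hne
    have hp0 : cubicContraction a b *ᵥ ((k 0 * τ ^ 2 + k 1 * τ + k 2) • p) = 0 := by
      have comm : cubicContraction a b *ᵥ quarticContraction 1 (-τ) *ᵥ w =
          cubicContraction 1 (-τ) *ᵥ quarticContraction a b *ᵥ w := by
        ext i
        fin_cases i <;> simp [cubicContraction, quarticContraction, Matrix.mulVec, dotProduct,
          Fin.sum_univ_succ] <;> ring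
      rw [← hw, comm, hab, Matrix.mulVec_zero]
    rw [Matrix.mulVec_smul, smul_eq_zero, or_iff_right hτ] at hp0
    obtain ⟨c, hc⟩ := cubicContraction_mulVec_eq_zero (by tauto) hp0
    exact hp a b c (by tauto) hc
  -- Three vectors in a plane are dependent; by `hind` the relation involves `r`, which is thus a
  -- contraction of `w`.
  let φ : (Fin 3 → ℝ) →ₗ[ℝ] LinearMap.ker (cubicContractionQuadratic k).mulVecLin :=
    Fintype.linearCombination ℝ ![⟨quarticContraction 1 0 *ᵥ w, hker w hkw _ _⟩,
      ⟨quarticContraction 0 1 *ᵥ w, hker w hkw _ _⟩, ⟨r, hkr⟩]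
  have hφ : LinearMap.ker φ ≠ ⊥ := by
    apply LinearMap.ker_ne_bot_of_finrank_lt
    rw [finrank_ker_cubicContractionQuadratic hk]
    simp
  obtain ⟨x, hx, hx0⟩ := (Submodule.ne_bot_iff _).1 hφ
  have hx' : quarticContraction (x 0) (x 1) *ᵥ w + x 2 • r = 0 := by
    have := congrArg Subtype.val (LinearMap.mem_ker.1 hx)
    simp [φ, Fintype.linearCombination_apply, Fin.sum_univ_three] at this
    rw [split]
    exact this
  have hx2 : x 2 ≠ 0 := by
    intro h2
    rw [h2, zero_smul, add_zero] at hx'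
    obtain ⟨h0, h1⟩ := hind _ _ hx'
    apply hx0
    ext i
    fin_cases i <;> assumption
  have smul (c a b : ℝ) : quarticContraction (c * a) (c * b) *ᵥ w =
      c • quarticContraction a b *ᵥ w := by
    rw [split, split w a b, smul_add, smul_smul, smul_smul]
  refine ⟨w, (k 0 * τ ^ 2 + k 1 * τ + k 2)⁻¹ * 1, (k 0 * τ ^ 2 + k 1 * τ + k 2)⁻¹ * (-τ),
    (-(x 2)⁻¹) * x 0, (-(x 2)⁻¹) * x 1, hkw, ?_, ?_⟩
  · rw [smul, hw, smul_smul, inv_mul_cancel₀ hτ, one_smul]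
  · rw [smul, eq_neg_of_add_eq_zero_left hx', smul_neg, neg_smul, neg_neg, smul_smul,
      inv_mul_cancel₀ hx2, one_smul]

/-- If the contraction of a point of a secant of the quartic curve by a linear form is not on the
twisted cubic, then the linear form does not divide the secant's form. -/
theorem dotProduct_quadraticMonomials_ne_zero {k : Fin 3 → ℝ} (hk : k ≠ 0) {w : Fin 5 → ℝ}
    (hkw : quarticContractionQuadratic k *ᵥ w = 0) {a b : ℝ} (hab : a ≠ 0 ∨ b ≠ 0)
    (hp : ∀ m n c : ℝ, (m ≠ 0 ∨ n ≠ 0) →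
      quarticContraction a b *ᵥ w ≠ c • cubicMonomials n (-m)) :
    k ⬝ᵥ quadraticMonomials b (-a) ≠ 0 := by
  intro h0
  simp [quadraticMonomials, dotProduct, Fin.sum_univ_succ] at h0
  -- Vanishing at (b, -a) factors `k` as (as + bt)(ms + nt). The contraction of `w` with as + bt is
  -- then killed by ms + nt, so it lies on the cubic.
  obtain ⟨m, n, e0, e1, e2⟩ :
      ∃ m n : ℝ, k 0 = a * m ∧ k 1 = a * n + b * m ∧ k 2 = b * n := by
    by_cases hb : b = 0
    · have ha : a ≠ 0 := by tauto
      subst hb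
      simp [ha] at h0
      exact ⟨k 0 / a, k 1 / a, by field_simp, by field_simp; ring, by simpa⟩
    · refine ⟨(k 1 - a * (k 2 / b)) / b, k 2 / b, ?_, ?_, ?_⟩ <;> field_simp
      · linear_combination h0
      · ring
  have hmn : m ≠ 0 ∨ n ≠ 0 := by
    by_contra! hmn
    apply hk
    ext i
    fin_cases i <;> simp [e0, e1, e2, hmn]
  have comm : cubicContraction m n *ᵥ quarticContraction a b *ᵥ w =
      quarticContractionQuadratic k *ᵥ w := by
    ext i
    fin_cases i <;> simp [cubicContraction, quarticContraction, quarticContractionQuadratic,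
      Matrix.mulVec, dotProduct, Fin.sum_univ_succ, e0, e1, e2] <;> ring
  rw [hkw] at comm
  obtain ⟨c, hc⟩ := cubicContraction_mulVec_eq_zero hmn comm
  exact hp m n c hmn hc

/-- Matrices killing a given vector factor through a common surjection. -/
theorem Matrix.exists_factor_of_mulVec_eq_zero {w : Fin 5 → ℝ} (hw : w ≠ 0) :
    ∃ E : Matrix (Fin 4) (Fin 5) ℝ, ∀ N : Matrix (Fin 3) (Fin 5) ℝ, N *ᵥ w = 0 →
      ∃ N' : Matrix (Fin 3) (Fin 4) ℝ, N' * E = N := by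
  obtain ⟨m, hm⟩ := Function.ne_iff.1 hw
  rw [Pi.zero_apply] at hm
  -- Projection from `w` onto the coordinate hyperplane opposite to a nonzero entry `w m`.
  refine ⟨Matrix.of fun a b => (if m.succAbove a = b then 1 else 0) -
    (if b = m then w (m.succAbove a) / w m else 0), fun N hN =>
    ⟨N.submatrix id m.succAbove, ?_⟩⟩
  ext i b
  have h0 := congrFun hN i
  rw [Matrix.mulVec, dotProduct, Fin.sum_univ_succAbove _ m] at h0
  rw [Matrix.mul_apply]
  induction b using Fin.succAboveCases m with
  | x =>
    simp only [submatrix_apply, id, of_apply, Fin.succAbove_ne, if_false, if_true, zero_sub,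
      mul_neg, Finset.sum_neg_distrib, ← mul_div_assoc, ← Finset.sum_div]
    rw [← neg_div, div_eq_iff hm]
    simp at h0
    linarith
  | p c => simp [Fin.succAbove_ne]

/-! ### One center on the cubic, two on a secant -/

namespace Configuration.IsCoordinates

variable {A : Configuration 3} {M : GL (Fin 4) ℝ} {R : Fin 3 → Matrix (Fin 3) (Fin 4) ℝ}
  {p : Fin 3 → Fin 4 → ℝ}

theorem mulVec_cubicMonomials_ne_zero (h : A.IsCoordinates M R p) {i : Fin 3}
    (hi : A.center i ∉ twistedCubic M) {s t : ℝ} (hst : s ≠ 0 ∨ t ≠ 0) :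
    R i *ᵥ cubicMonomials s t ≠ 0 := by
  intro h0
  refine hi (h.center_mem_twistedCubic (s := s) (t := t) (by simpa) ?_)
  rw [cubicMonomials_ofReal, toComplex_mulVec_ofReal, h0]
  ext
  simp

theorem ne_smul_cubicMonomials (h : A.IsCoordinates M R p) {i : Fin 3}
    (hi : A.center i ∉ twistedCubic M) (a b c : ℝ) (hab : a ≠ 0 ∨ b ≠ 0) :
    p i ≠ c • cubicMonomials b (-a) := by
  intro hp
  have h0 := h.mulVec_self i
  rw [hp, Matrix.mulVec_smul, smul_eq_zero,
    or_iff_left (h.mulVec_cubicMonomials_ne_zero hi (by simp; tauto))] at h0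
  apply h.ne_zero i
  rw [hp, h0, zero_smul]

set_option maxHeartbeats 1000000 in
/-- One center on the twisted cubic, and two centers on the same secant line, whose points on the
twisted cubic are the zeros of the quadratic form `k`. -/
theorem isCritical_of_secant (h : A.IsCoordinates M R p) (hX : A.points ⊆ twistedCubic M)
    {i j l : Fin 3} (hij : i ≠ j) (hil : i ≠ l) (hjl : j ≠ l) (hi : A.center i ∈ twistedCubic M)
    (hj : A.center j ∉ twistedCubic M) (hl : A.center l ∉ twistedCubic M) {k : Fin 3 → ℝ}
    (hk : k ≠ 0) (hkj : cubicContractionQuadratic k *ᵥ p j = 0)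
    (hkl : cubicContractionQuadratic k *ᵥ p l = 0) : A.IsCritical := by
  obtain ⟨a, b, c, G, G', hab, hG, hR, hc, hp⟩ := h.exists_eq_mul hi
  obtain ⟨w, a₁, b₁, a₂, b₂, hkw, hw₁, hw₂⟩ :=
    exists_quarticContraction_eq hk hkj hkl (h.ne_smul_cubicMonomials hj)
  have hw : w ≠ 0 := by
    rintro rfl
    rw [Matrix.mulVec_zero] at hw₁
    exact h.ne_zero j hw₁.symm
  have contraction_zero : quarticContraction (0 : ℝ) 0 = 0 := by
    ext i j
    fin_cases i <;> fin_cases j <;> rfl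
  have hab₁ : a₁ ≠ 0 ∨ b₁ ≠ 0 := by
    by_contra! h0
    rw [h0.1, h0.2, contraction_zero, Matrix.zero_mulVec] at hw₁
    exact h.ne_zero j hw₁.symm
  have hab₂ : a₂ ≠ 0 ∨ b₂ ≠ 0 := by
    by_contra! h0
    rw [h0.1, h0.2, contraction_zero, Matrix.zero_mulVec] at hw₂
    exact h.ne_zero l hw₂.symm
  have hk₁ : k ⬝ᵥ quadraticMonomials b₁ (-a₁) ≠ 0 :=
    dotProduct_quadraticMonomials_ne_zero hk hkw hab₁
      (by rw [hw₁]; exact h.ne_smul_cubicMonomials hj)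
  have hk₂ : k ⬝ᵥ quadraticMonomials b₂ (-a₂) ≠ 0 :=
    dotProduct_quadraticMonomials_ne_zero hk hkw hab₂
      (by rw [hw₂]; exact h.ne_smul_cubicMonomials hl)
  -- Proportional linear forms would contract `w` to the same point, but the centers `j` and `l` are
  -- distinct.
  have hdet : a₁ * b₂ - b₁ * a₂ ≠ 0 := by
    intro hdet
    have e1 : a₁ • p l = a₂ • p j := by
      rw [← hw₁, ← hw₂]
      ext m
      fin_cases m <;> simp [quarticContraction, dotProduct, Fin.sum_univ_succ]
      · linear_combination w 1 * hdet
      · linear_combination w 2 * hdet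
      · linear_combination w 3 * hdet
      · linear_combination w 4 * hdet
    have e2 : b₁ • p l = b₂ • p j := by
      rw [← hw₁, ← hw₂]
      ext m
      fin_cases m <;> simp [quarticContraction, dotProduct, Fin.sum_univ_succ]
      · linear_combination -w 0 * hdet
      · linear_combination -w 1 * hdet
      · linear_combination -w 2 * hdet
      · linear_combination -w 3 * hdet
    have h1 := congrArg (R j *ᵥ ·) e1
    have h2 := congrArg (R j *ᵥ ·) e2
    simp only [Matrix.mulVec_smul, h.mulVec_self, smul_zero, smul_eq_zero,
      h.mulVec_center_ne_zero hjl, or_false] at h1 h2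
    tauto
  obtain ⟨E, hE⟩ := Matrix.exists_factor_of_mulVec_eq_zero hw
  obtain ⟨P, hP⟩ := hE (G * quarticContractionQuadratic k)
    (by rw [← Matrix.mulVec_mulVec, hkw, Matrix.mulVec_zero])
  obtain ⟨Q, hQ⟩ := hE (R j * quarticContraction a₁ b₁)
    (by rw [← Matrix.mulVec_mulVec, hw₁, h.mulVec_self])
  obtain ⟨S, hS⟩ := hE (R l * quarticContraction a₂ b₂)
    (by rw [← Matrix.mulVec_mulVec, hw₂, h.mulVec_self])
  have hP' (x : Fin 5 → ℝ) : P *ᵥ E *ᵥ x = G *ᵥ quarticContractionQuadratic k *ᵥ x := by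
    rw [Matrix.mulVec_mulVec, hP, Matrix.mulVec_mulVec]
  have hQ' (x : Fin 5 → ℝ) : Q *ᵥ E *ᵥ x = R j *ᵥ quarticContraction a₁ b₁ *ᵥ x := by
    rw [Matrix.mulVec_mulVec, hQ, Matrix.mulVec_mulVec]
  have hS' (x : Fin 5 → ℝ) : S *ᵥ E *ᵥ x = R l *ᵥ quarticContraction a₂ b₂ *ᵥ x := by
    rw [Matrix.mulVec_mulVec, hS, Matrix.mulVec_mulVec]
  -- A second vector of the kernel of contraction with `k`, independent of `w`; its projection `E *ᵥ
  -- ν` is the center of the new camera `P`.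
  obtain ⟨ν, hν0, hν⟩ := exists_dotProduct_eq_zero 4 (by norm_num)
    (![quarticContractionQuadratic k 0, quarticContractionQuadratic k 1,
      quarticContractionQuadratic k 2, w] : Fin 4 → Fin 5 → ℝ)
  have hkν : quarticContractionQuadratic k *ᵥ ν = 0 := by
    ext m
    fin_cases m
    · exact hν 0
    · exact hν 1
    · exact hν 2
  have hwν (d : ℝ) : ν ≠ d • w := by
    intro hd
    have h3 : w ⬝ᵥ ν = 0 := hν 3
    rw [hd, dotProduct_smul, smul_eq_zero, or_iff_left (fun h0 => hw (dotProduct_self_eq_zero.1 h0))]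
      at h3
    rw [h3, zero_smul] at hd
    exact hν0 hd
  have image_node {m : Fin 3} {a b : ℝ} (hab : a ≠ 0 ∨ b ≠ 0)
      (hwm : quarticContraction a b *ᵥ w = p m) (hkm : k ⬝ᵥ quadraticMonomials b (-a) ≠ 0) :
      R m *ᵥ quarticContraction a b *ᵥ ν ≠ 0 := by
    intro h0
    obtain ⟨d, hd⟩ := h.eq_smul h0
    rw [← hwm, ← Matrix.mulVec_smul, ← sub_eq_zero, ← Matrix.mulVec_sub] at hd
    obtain ⟨e, he⟩ := quarticContraction_mulVec_eq_zero hab hd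
    have h1 := congrArg (quarticContractionQuadratic k *ᵥ ·) he
    simp only [Matrix.mulVec_sub, Matrix.mulVec_smul, hkν, hkw, smul_zero, sub_zero,
      quarticContractionQuadratic_mulVec_quarticMonomials] at h1
    have hcon : quadraticMonomials b (-a) ≠ 0 := by
      rw [Ne, quadraticMonomials_eq_zero]
      simp
      tauto
    rw [smul_smul, eq_comm, smul_eq_zero, or_iff_left hcon, mul_eq_zero, or_iff_left hkm] at h1
    rw [h1, zero_smul, sub_eq_zero] at he
    exact hwν d he
  -- Up to `G`, the old epipole lies on the line `k` of the image plane because the center of `m` is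
  -- on the secant; the new one is a multiple of a conic point off that line.
  have epipole {m : Fin 3} {a' b' : ℝ} (him : i ≠ m)
      (hkm : cubicContractionQuadratic k *ᵥ p m = 0)
      (hk' : k ⬝ᵥ quadraticMonomials b' (-a') ≠ 0) (d : ℝ) :
      R i *ᵥ p m ≠ d • P *ᵥ E *ᵥ quarticMonomials b' (-a') := by
    intro hd
    have hne := h.mulVec_center_ne_zero him
    rw [hP', hR, ← Matrix.mulVec_mulVec, ← Matrix.mulVec_smul, ← sub_eq_zero, ← Matrix.mulVec_sub,
      Matrix.mulVec_eq_zero_of_left_inverse hG, sub_eq_zero,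
      quarticContractionQuadratic_mulVec_quarticMonomials, smul_smul] at hd
    have h1 := congrArg (k ⬝ᵥ ·) hd
    simp only [dotProduct_cubicContraction_mulVec, hkm, dotProduct_zero, dotProduct_smul,
      smul_eq_mul] at h1
    rw [eq_comm, mul_eq_zero, or_iff_left hk'] at h1
    rw [hR, ← Matrix.mulVec_mulVec, hd, h1, zero_smul, Matrix.mulVec_zero] at hne
    exact hne rfl
  have hcub₁ : R l *ᵥ cubicMonomials b₁ (-a₁) ≠ 0 :=
    h.mulVec_cubicMonomials_ne_zero hl (by simp; tauto)
  have hcub₂ : R j *ᵥ cubicMonomials b₂ (-a₂) ≠ 0 :=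
    h.mulVec_cubicMonomials_ne_zero hj (by simp; tauto)
  have hcon₁ : quadraticMonomials b₁ (-a₁) ≠ 0 := by
    rintro h0
    simp [h0] at hk₁
  have hcon₂ : quadraticMonomials b₂ (-a₂) ≠ 0 := by
    rintro h0
    simp [h0] at hk₂
  -- The contractions with ℓ₁ and ℓ₂ vanish at the quartic points of their roots, so these points
  -- project to the new centers for `j` and `l`.
  refine h.isCritical_of_cameras hX hij hil hjl (P := P) (Q := Q) (S := S) (u := E *ᵥ ν)
    (v := E *ᵥ quarticMonomials b₁ (-a₁)) (w := E *ᵥ quarticMonomials b₂ (-a₂))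
    ?_ ?_ ?_ ?_ ?_ ?_ ?_ ?_ ?_ ?_ ?_ ?_ (epipole hij hkj hk₁) (epipole hil hkl hk₂) ?_ ?_
  · intro y
    obtain ⟨x, hx⟩ := Matrix.mulVec_surjective_mul_of_left_inverse hG
      (exists_quarticContractionQuadratic_mulVec_eq hk) y
    exact ⟨E *ᵥ x, by rw [hP', Matrix.mulVec_mulVec]; exact hx⟩
  · intro y
    obtain ⟨z, hz⟩ := h.surjective j y
    obtain ⟨x, hx⟩ := exists_quarticContraction_mulVec_eq hab₁ z
    exact ⟨E *ᵥ x, by rw [hQ', hx]; exact hz⟩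
  · intro y
    obtain ⟨z, hz⟩ := h.surjective l y
    obtain ⟨x, hx⟩ := exists_quarticContraction_mulVec_eq hab₂ z
    exact ⟨E *ᵥ x, by rw [hS', hx]; exact hz⟩
  · rw [hP', hkν, Matrix.mulVec_zero]
  · rw [hQ', quarticContraction_mulVec_quarticMonomials,
      show a₁ * b₁ + b₁ * -a₁ = 0 by ring, zero_smul, Matrix.mulVec_zero]
  · rw [hS', quarticContraction_mulVec_quarticMonomials,
      show a₂ * b₂ + b₂ * -a₂ = 0 by ring, zero_smul, Matrix.mulVec_zero]
  · rw [hP', Ne, Matrix.mulVec_eq_zero_of_left_inverse hG,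
      quarticContractionQuadratic_mulVec_quarticMonomials, smul_eq_zero]
    exact not_or.2 ⟨hk₁, hcon₁⟩
  · rw [hP', Ne, Matrix.mulVec_eq_zero_of_left_inverse hG,
      quarticContractionQuadratic_mulVec_quarticMonomials, smul_eq_zero]
    exact not_or.2 ⟨hk₂, hcon₂⟩
  · rw [hQ']
    exact image_node hab₁ hw₁ hk₁
  · rw [hQ', quarticContraction_mulVec_quarticMonomials, Matrix.mulVec_smul]
    exact smul_ne_zero (fun h0 => hdet (by linarith)) hcub₂
  · rw [hS']
    exact image_node hab₂ hw₂ hk₂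
  · rw [hS', quarticContraction_mulVec_quarticMonomials, Matrix.mulVec_smul]
    exact smul_ne_zero (fun h0 => hdet (by linarith)) hcub₁
  -- Equal epipoles would make `p l`, modulo `p j`, a multiple of the cubic point at the root of ℓ₂.
  -- Contraction with `k` kills both centers but not that point, so the multiple is zero and the
  -- centers coincide.
  · intro d hd
    have hne := h.mulVec_center_ne_zero hjl
    rw [hQ', quarticContraction_mulVec_quarticMonomials, ← Matrix.mulVec_smul, smul_smul,
      ← sub_eq_zero, ← Matrix.mulVec_sub] at hd
    obtain ⟨e, he⟩ := h.eq_smul hd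
    have h1 := congrArg (cubicContractionQuadratic k *ᵥ ·) he
    simp only [Matrix.mulVec_sub, Matrix.mulVec_smul, hkj, hkl, smul_zero, zero_sub,
      cubicContractionQuadratic_mulVec_cubicMonomials] at h1
    have hst : (![b₂, -a₂] : Fin 2 → ℝ) ≠ 0 := by
      intro h0
      have h00 := congrFun h0 0
      have h01 := congrFun h0 1
      simp at h00 h01
      exact hab₂.elim (absurd h01) (absurd h00)
    rw [neg_eq_zero, smul_smul, smul_eq_zero, or_iff_left hst, mul_eq_zero, or_iff_left hk₂] at h1
    rw [h1, zero_smul, sub_zero] at he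
    rw [he, Matrix.mulVec_smul, h.mulVec_self, smul_zero] at hne
    exact hne rfl
  · intro s t hst
    have hcub {m : Fin 3} (hm : A.center m ∉ twistedCubic M) :
        (R m).toComplex *ᵥ cubicMonomials s t ≠ 0 :=
      fun h0 => hm (h.center_mem_twistedCubic hst h0)
    have hcon : quadraticMonomials s t ≠ 0 := by
      rw [Ne, quadraticMonomials_eq_zero]
      tauto
    have yP : P.toComplex *ᵥ E.toComplex *ᵥ quarticMonomials s t =
        ((fun m => (k m : ℂ)) ⬝ᵥ quadraticMonomials s t) •
          G.toComplex *ᵥ quadraticMonomials s t := by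
      rw [Matrix.mulVec_mulVec, ← Matrix.toComplex_mul, hP, Matrix.toComplex_mul,
        toComplex_quarticContractionQuadratic, ← Matrix.mulVec_mulVec,
        quarticContractionQuadratic_mulVec_quarticMonomials, Matrix.mulVec_smul]
    have yQ : Q.toComplex *ᵥ E.toComplex *ᵥ quarticMonomials s t =
        (a₁ * s + b₁ * t) • (R j).toComplex *ᵥ cubicMonomials s t := by
      rw [Matrix.mulVec_mulVec, ← Matrix.toComplex_mul, hQ, Matrix.toComplex_mul,
        toComplex_quarticContraction, ← Matrix.mulVec_mulVec,
        quarticContraction_mulVec_quarticMonomials, Matrix.mulVec_smul]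
    have yS : S.toComplex *ᵥ E.toComplex *ᵥ quarticMonomials s t =
        (a₂ * s + b₂ * t) • (R l).toComplex *ᵥ cubicMonomials s t := by
      rw [Matrix.mulVec_mulVec, ← Matrix.toComplex_mul, hS, Matrix.toComplex_mul,
        toComplex_quarticContraction, ← Matrix.mulVec_mulVec,
        quarticContraction_mulVec_quarticMonomials, Matrix.mulVec_smul]
    refine ⟨E.toComplex *ᵥ quarticMonomials s t, fun h0 => ?_,
      ⟨_, Matrix.toComplex_mulVec_ne_zero_of_left_inverse hG hcon, ⟨a * s + b * t, ?_⟩,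
        _, yP.symm⟩,
      ⟨_, hcub hj, ⟨1, one_smul _ _⟩, _, yQ.symm⟩, ⟨_, hcub hl, ⟨1, one_smul _ _⟩, _, yS.symm⟩⟩
    -- If the projection from `w` killed a quartic point, both ℓ₁ and ℓ₂ would vanish at (s, t),
    -- contradicting their independence.
    · rw [h0, Matrix.mulVec_zero, eq_comm, smul_eq_zero, or_iff_left (hcub hj)] at yQ
      rw [h0, Matrix.mulVec_zero, eq_comm, smul_eq_zero, or_iff_left (hcub hl)] at yS
      have hdet' : (a₁ * b₂ - b₁ * a₂ : ℂ) ≠ 0 := by exact_mod_cast hdet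
      have hs : (a₁ * b₂ - b₁ * a₂ : ℂ) * s = 0 := by linear_combination b₂ * yQ - b₁ * yS
      have ht : (a₁ * b₂ - b₁ * a₂ : ℂ) * t = 0 := by linear_combination a₁ * yS - a₂ * yQ
      simp only [mul_eq_zero, hdet', false_or] at hs ht
      exact hst.elim (absurd hs) (absurd ht)
    · rw [hR, Matrix.toComplex_mul, toComplex_cubicContraction, ← Matrix.mulVec_mulVec,
        cubicContraction_mulVec_cubicMonomials, Matrix.mulVec_smul]

theorem exists_smul_add_smul_of_mem_lineThrough (h : A.IsCoordinates M R p) {i : Fin 3}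
    {v w : Fin 4 → ℂ} (hv : M.val.toComplex *ᵥ v ≠ 0) (hw : M.val.toComplex *ᵥ w ≠ 0)
    (hi : A.center i ∈ lineThrough (Projectivization.mk ℂ _ hv) (Projectivization.mk ℂ _ hw)) :
    ∃ α β : ℂ, (fun m => (p i m : ℂ)) = α • v + β • w := by
  rw [h.center_eq_mk] at hi
  rw [lineThrough, Set.mem_ofPred_eq] at hi
  rw [Projectivization.submodule_mk, Projectivization.submodule_mk, Projectivization.submodule_mk,
    Submodule.span_singleton_le_iff_mem, Submodule.mem_sup] at hi
  obtain ⟨x, hx, y, hy, hxy⟩ := hi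
  obtain ⟨α, rfl⟩ := Submodule.mem_span_singleton.1 hx
  obtain ⟨β, rfl⟩ := Submodule.mem_span_singleton.1 hy
  refine ⟨α, β, ?_⟩
  by_contra hne
  apply toComplex_mulVec_ne_zero M (sub_ne_zero.2 hne)
  rw [Matrix.mulVec_sub, ← hxy, Matrix.mulVec_add, Matrix.mulVec_smul, Matrix.mulVec_smul, sub_self]

/-- A real quadratic form vanishing on the points of the twisted cubic on a secant line. -/
theorem exists_quadratic_of_isSecant (h : A.IsCoordinates M R p) {L : Set (ProjSpace 3)}
    (hL : IsSecant L (twistedCubic M)) : ∃ k : Fin 3 → ℝ, k ≠ 0 ∧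
      ∀ i, A.center i ∈ L → cubicContractionQuadratic k *ᵥ p i = 0 := by
  obtain ⟨_, ⟨s, t, hst, rfl⟩, _, ⟨s', t', hst', rfl⟩, -, rfl⟩ := hL
  -- The product of the two linear forms vanishing at (s, t) and at (s', t').
  let κ : Fin 3 → ℂ := ![t * t', -(s * t' + t * s'), s * s']
  have hne {s t : ℂ} (hst : M.val.toComplex *ᵥ cubicMonomials s t ≠ 0) : s ≠ 0 ∨ t ≠ 0 := by
    by_contra! h0
    rw [cubicMonomials_eq_zero.2 h0, Matrix.mulVec_zero] at hst
    exact hst rfl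
  have hκ0 : κ ≠ 0 := by
    intro h0
    have h1 := congrFun h0 0
    have h2 := congrFun h0 1
    have h3 := congrFun h0 2
    simp [κ] at h1 h2 h3
    have := hne hst
    have := hne hst'
    by_cases s = 0 <;> by_cases t = 0 <;> simp_all
  have hκ (i : Fin 3) (hi : A.center i ∈ lineThrough (Projectivization.mk ℂ _ hst)
      (Projectivization.mk ℂ _ hst')) :
      cubicContractionQuadratic κ *ᵥ (fun m => (p i m : ℂ)) = 0 := by
    obtain ⟨α, β, hp⟩ := h.exists_smul_add_smul_of_mem_lineThrough hst hst' hi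
    change _ = α • cubicMonomials s t + β • cubicMonomials s' t' at hp
    have z1 : κ ⬝ᵥ quadraticMonomials s t = 0 := by
      simp [κ, quadraticMonomials, dotProduct, Fin.sum_univ_succ]
      ring
    have z2 : κ ⬝ᵥ quadraticMonomials s' t' = 0 := by
      simp [κ, quadraticMonomials, dotProduct, Fin.sum_univ_succ]
      ring
    rw [hp, Matrix.mulVec_add, Matrix.mulVec_smul, Matrix.mulVec_smul,
      cubicContractionQuadratic_mulVec_cubicMonomials,
      cubicContractionQuadratic_mulVec_cubicMonomials, z1, z2]
    simp
  -- The centers are real, so the real and imaginary parts of `κ` each kill them; one of the two is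
  -- nonzero.
  by_cases hre : (fun m => (κ m).re) = 0
  · refine ⟨fun m => (κ m).im, fun him => hκ0 ?_, fun i hi => ?_⟩
    · ext m
      exact Complex.ext (congrFun hre m) (congrFun him m)
    · ext m
      have := congrArg Complex.im (congrFun (hκ i hi) m)
      fin_cases m <;>
      simpa [cubicContractionQuadratic, Matrix.mulVec, dotProduct, Fin.sum_univ_succ] using this
  · refine ⟨fun m => (κ m).re, hre, fun i hi => ?_⟩
    ext m
    have := congrArg Complex.re (congrFun (hκ i hi) m)
    fin_cases m <;>
    simpa [cubicContractionQuadratic, Matrix.mulVec, dotProduct, Fin.sum_univ_succ] using this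

end Configuration.IsCoordinates

theorem mainTheorem9 (A : Configuration 3) (C : Set (ProjSpace 3)) (hC : IsTwistedCubic C)
    (hX : A.points ⊆ C) :
    (∀ i j : Fin 3, i ≠ j → A.center i ∈ C → A.center j ∈ C → A.IsCritical) ∧
    (∀ i j k : Fin 3, i ≠ j → i ≠ k → j ≠ k →
      A.center i ∈ C → A.center j ∉ C → A.center k ∉ C →
      (∃ L, IsSecant L C ∧ A.center j ∈ L ∧ A.center k ∈ L) → A.IsCritical) ∧
    ((∀ i : Fin 3, A.center i ∈ C) →
      A.IsCritical ∧
      ∃ B : Configuration 3, A.IsNontrivialConjugate B ∧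
        ∃ D, IsConic D ∧ B.points ⊆ D ∧ ∀ i, B.center i ∉ D) := by
  obtain ⟨M, hM⟩ := hC
  obtain rfl : C = twistedCubic M := hM
  obtain ⟨R, p, h⟩ := A.exists_isCoordinates M
  refine ⟨fun i j hij hi hj => ?_, fun i j k hij hik hjk hi hj hk ⟨L, hL, hjL, hkL⟩ => ?_,
    fun hc => ?_⟩
  · obtain ⟨l, hli, hlj⟩ : ∃ l : Fin 3, l ≠ i ∧ l ≠ j :=
      (by decide : ∀ i j : Fin 3, ∃ l, l ≠ i ∧ l ≠ j) i j
    exact h.isCritical_of_two_mem hX hli hlj hij hi hj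
  · obtain ⟨q, hq, hq'⟩ := h.exists_quadratic_of_isSecant hL
    exact h.isCritical_of_secant hX hij hik hjk hi hj hk hq (hq' j hjL) (hq' k hkL)
  · obtain ⟨B, hB, hD⟩ := h.exists_conjugate_conic hX hc
    exact ⟨⟨B, hB⟩, B, hB, hD⟩
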